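/- Let $\Gamma$ be a compact connected metric graph, realized from a finite simple graph model $G=(V,E)$ with positive edge lengths. For $x\in\Gamma$, $\mathrm{T}_x(\Gamma)$ is the set of outgoing unit tangent directions at $x$, $\mathrm{Rat}(\Gamma)$ is the set of continuous piecewise affine functions $f:\Gamma\to\mathbb R$ with integral slopes, $\delta_x(f)\in\mathbb Z^{\mathrm{T}_x(\Gamma)}$ is the vector of outgoing slopes of $f$ at $x$, and $\mathrm{div}(f)=\sum_x \bigl(-\sum_{\nu\in \mathrm{T}_x(\Gamma)}\mathrm{slope}_\nu(f)\bigr)\,x$. For a divisor $D$, $\mathrm{Rat}(D)=\{f\in\mathrm{Rat}(\Gamma): D+\mathrm{div}(f)\ge 0\}$. Let $r\ge 0$. A rank function on $\{0,\dots,r\}^{\delta}$ is a supermodular, coordinatewise non-increasing function $\rho$ with values in $\{-1,0,\dots,r\}$ and $\rho(t e_i)=r-t$ for all $i$ and $0\le t\le r$; a jump of $\rho$ is a point $a$ with $\rho(a)\ge 0$ and $\rho(a+e_i)=\rho(a)-1$ whenever $a+e_i$ is in the hypercube. An $r$-slope structure $\mathfrak S$ on $\Gamma$ consists of integers $s^e_0<\dots<s^e_r$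 for every oriented edge $e$ of $G$, with $s^{e}_i+s^{\bar e}_{r-i}=0$ for the reversed edge $\bar e$, and of a rank function $\rho_x$ on $\{0,\dots,r\}^{\mathrm{T}_x(\Gamma)}$ for every $x\in\Gamma$, which for $x\notin V$ is the standard one, $(i,j)\mapsto r-i-j$ if $i+j\le r$ and $-1$ otherwise. A direction $\nu\in \mathrm{T}_x(\Gamma)$ gets the slopes $s^\nu_i=s^e_i$ of the oriented edge $e$ parallel to it. Write $s_a=(s^\nu_{a_\nu})_{\nu}$ for $a\in\{0,\dots,r\}^{\mathrm{T}_x(\Gamma)}$, and $\rho_x(s_a)=\rho_x(a)$. For a divisor $D$ of degree $d$, $\mathrm{Rat}(D,\mathfrak S)$ is the set of $f\in\mathrm{Rat}(D)$ such that, for every $x\in \Gamma$, $\delta_x(f)=s_a$ for a jump $a$ of $\rho_x$. A set $M\subseteq\mathrm{Rat}(D,\mathfrak S)$ has the rank property if for every effective divisor $E$ of degree $r$ there is $f\in M$ with $\rho_x(\delta_x(f))\ge E(x)$ for all $x\in \Gamma$ and $D+\mathrm{div}(f)-E\ge 0$. The pair $(D,\mathfrak S)$ is a crude linear series if $\mathrm{Rat}(D,\mathfrak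 S)$ has the rank property. A $\mathfrak g^r_d$ associated to it is a set $M\subseteq\mathrm{Rat}(D,\mathfrak S)$ which is closed under pointwise minimum and under addition of real constants, closed in $(\mathrm{Rat}(D),\|\cdot\|_\infty)$, and has the rank property. **Theorem.** Let $M$ be a $\mathfrak g^r_d$ associated to a crude linear series $(D,\mathfrak S)$ on $\Gamma$. For $v\in\Gamma$ let $f_v(x)=\inf_{g\in M}\,[g(x)-g(v)]$; this is a well-defined element of $M$. Let $D_v=D+\mathrm{div}(f_v)$ be the $v$-reduced divisor with respect to $M$. Let $|M|$ be the set of effective divisors of the form $D+\mathrm{div}(f)$ with $f\in M$, viewed as a subspace of the symmetric product $\mathrm{Sym}^d(\Gamma)=\Gamma^d/S_d$ with its quotient topology. Then the map $\mathrm{Red}:\Gamma\to|M|$, $v\mapsto D_v$, is well defined and continuous, and if $r\ge 1$ it is non-contracting, i.e. it is not constant on any segment of positive length of $\Gamma$. -/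

import Mathlib

open Set Filter Topology

/-! ### Rank functions on hypercubes

The hypercube of width `r` with set of directions `ι` is `ι → Fin (r + 1)`. -/

section Hypercube

variable {ι : Type*} {r : ℕ}

/-- Hypercube rank functions. -/
structure IsRankFunction (ρ : (ι → Fin (r + 1)) → ℤ) : Prop where
  supermodular : ∀ a b, ρ a + ρ b ≤ ρ (a ⊔ b) + ρ (a ⊓ b)
  mem_range : ∀ a, -1 ≤ ρ a ∧ ρ a ≤ r
  antitone : Antitone ρ
  /-- The value at the point with coordinate `t` in direction `i` and `0` elsewhere is `r - t`. -/
  axis : ∀ (i : ι) (a : ι → Fin (r + 1)), (∀ j, j ≠ i → a j = 0) → ρ a = r - ((a i : ℕ) : ℤ)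

/-- The set of jumps of `ρ`; below, `b` is the point `a + e_i`. -/
def jumps (ρ : (ι → Fin (r + 1)) → ℤ) : Set (ι → Fin (r + 1)) :=
  {a | 0 ≤ ρ a ∧ ∀ (i : ι) (b : ι → Fin (r + 1)), (∀ j, j ≠ i → b j = a j) →
    (b i : ℕ) = (a i : ℕ) + 1 → ρ b = ρ a - 1}

/-- The standard rank function. -/
def standardRank [Fintype ι] (a : ι → Fin (r + 1)) : ℤ :=
  if ∑ i, (a i : ℕ) ≤ r then r - ((∑ i, (a i : ℕ) : ℕ) : ℤ) else -1

end Hypercube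

/-! ### Metric graphs -/

/-- A compact connected metric graph, given by a model: a finite connected simple graph together
with positive edge lengths. Darts are the oriented edges. -/
structure MetricGraph (V : Type*) where
  graph : SimpleGraph V
  connected : graph.Connected
  len : graph.Dart → ℝ
  len_pos : ∀ e, 0 < len e
  len_symm : ∀ e : graph.Dart, len e.symm = len e

namespace MetricGraph

variable {V : Type*} (Γ : MetricGraph V)

/-- The disjoint union of the vertices and of one interval for each oriented edge. -/
abbrev Pre : Type _ := V ⊕ (Σ e : Γ.graph.Dart, Icc (0 : ℝ) (Γ.len e))

/-- The gluing: the origin of the interval of `e` is the tail of `e`, and the intervals of the two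
orientations of an edge are identified by reversal. -/
inductive Glue : Γ.Pre → Γ.Pre → Prop
  | tail (e : Γ.graph.Dart) (t : Icc (0 : ℝ) (Γ.len e)) (ht : (t : ℝ) = 0) :
      Glue (Sum.inr ⟨e, t⟩) (Sum.inl e.fst)
  | flip (e : Γ.graph.Dart) (s : Icc (0 : ℝ) (Γ.len e)) (t : Icc (0 : ℝ) (Γ.len e.symm))
      (h : (s : ℝ) + t = Γ.len e) : Glue (Sum.inr ⟨e, s⟩) (Sum.inr ⟨e.symm, t⟩)

/-- The points of the metric graph: the metric realization of the model. -/
def Point : Type _ := Quot Γ.Glue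

/-- The quotient topology (vertices are isolated in the disjoint union); it is the topology of the
path metric. -/
instance : TopologicalSpace Γ.Point :=
  letI : TopologicalSpace V := ⊥
  letI : TopologicalSpace Γ.graph.Dart := ⊥
  inferInstanceAs (TopologicalSpace (Quot Γ.Glue))

instance [Finite V] : CompactSpace Γ.Point := by
  let : TopologicalSpace V := ⊥
  let : TopologicalSpace Γ.graph.Dart := ⊥
  have : Finite Γ.graph.Dart := Finite.of_injective _ SimpleGraph.Dart.toProd_injective
  exact inferInstanceAs (CompactSpace (Quot Γ.Glue))

/-- The point of the metric graph given by a vertex. -/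
def vtx (v : V) : Γ.Point := Quot.mk _ (Sum.inl v)

/-- The point of the oriented edge `e` at distance `t` from its tail, for `0 ≤ t ≤ len e`
(the parameter is clamped to this interval). -/
noncomputable def pt (e : Γ.graph.Dart) (t : ℝ) : Γ.Point :=
  Quot.mk _ (Sum.inr ⟨e, projIcc 0 (Γ.len e) (Γ.len_pos e).le t⟩)

open Classical in
/-- Auxiliary coordinate along an oriented edge, used to separate its points. -/
noncomputable def coordPre (e : Γ.graph.Dart) : Γ.Pre → ℝ
  | Sum.inl v => if v = e.fst then 0 else if v = e.snd then Γ.len e else -1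
  | Sum.inr ⟨e', t⟩ =>
      if e' = e then t else if e' = e.symm then Γ.len e - t else
        if (t : ℝ) = 0 then
          (if e'.fst = e.fst then 0 else if e'.fst = e.snd then Γ.len e else -1)
        else if (t : ℝ) = Γ.len e' then
          (if e'.snd = e.fst then 0 else if e'.snd = e.snd then Γ.len e else -1)
        else -1

theorem coordPre_glue (e : Γ.graph.Dart) (p q : Γ.Pre) (h : Γ.Glue p q) :
    Γ.coordPre e p = Γ.coordPre e q := by
  have hne : e.snd ≠ e.fst := e.adj.ne'
  cases h with
  | tail e' t ht =>
    by_cases h1 : e' = e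
    · subst h1; simp [coordPre, ht]
    · by_cases h2 : e' = e.symm
      · subst h2; simp [coordPre, ht, h1, hne]
      · simp [coordPre, ht, h1, h2]
  | flip e' s t h =>
    have hp := Γ.len_pos e'
    have hs := Γ.len_symm e'
    by_cases h1 : e' = e
    · subst h1
      have h3 : e'.symm ≠ e' := SimpleGraph.Dart.symm_ne e'
      simp [coordPre, h3]; linarith
    · by_cases h2 : e' = e.symm
      · subst h2
        have h3 : Γ.len e.symm = Γ.len e := Γ.len_symm e
        simp [coordPre, h1]; linarith
      · have h3 : e'.symm ≠ e := fun h => h2 (by rw [← h]; simp)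
        have h4 : e'.symm ≠ e.symm := fun h => h1 (by simpa using congrArg SimpleGraph.Dart.symm h)
        have hs0 : (s : ℝ) = 0 ↔ (t : ℝ) = Γ.len e' := by constructor <;> intro <;> linarith
        have ht0 : (t : ℝ) = 0 ↔ (s : ℝ) = Γ.len e' := by constructor <;> intro <;> linarith
        simp only [coordPre, h1, h2, h3, h4, if_false, hs, ht0, hs0]
        by_cases h5 : (t : ℝ) = Γ.len e'
        · have h6 : (s : ℝ) ≠ Γ.len e' := by intro h6; linarith
          simp [h5, h6, SimpleGraph.Dart.symm]
          congr
        · by_cases h6 : (s : ℝ) = Γ.len e'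
          · simp [h5, h6, SimpleGraph.Dart.symm]
            congr
          · simp [h5, h6]

theorem pt_injOn (e : Γ.graph.Dart) : InjOn (Γ.pt e) (Icc 0 (Γ.len e)) := by
  intro s hs t ht hst
  have h := congrArg (Quot.lift (Γ.coordPre e) (Γ.coordPre_glue e)) hst
  simpa [pt, coordPre, projIcc_of_mem _ hs, projIcc_of_mem _ ht] using h

/-- The unit tangent vectors (outgoing directions) at `x`: an oriented edge `dart` together with a
position `pos` on it, its head excluded, at which `x` lies; `dart` is the oriented edge parallel to
the tangent vector. A vertex has one for each oriented edge with this tail, a point in the interior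
of an edge has two. -/
@[ext]
structure Tangent (x : Γ.Point) where
  dart : Γ.graph.Dart
  pos : ℝ
  pos_nonneg : 0 ≤ pos
  pos_lt : pos < Γ.len dart
  base : Γ.pt dart pos = x

instance [Finite V] (x : Γ.Point) : Finite (Γ.Tangent x) := by
  have : Finite Γ.graph.Dart := Finite.of_injective _ SimpleGraph.Dart.toProd_injective
  refine Finite.of_injective (fun ν : Γ.Tangent x => ν.dart) ?_
  rintro ⟨e, s, hs, hs', hb⟩ ⟨e', t, ht, ht', hb'⟩ h
  obtain rfl : e = e' := h
  obtain rfl : s = t := Γ.pt_injOn e ⟨hs, hs'.le⟩ ⟨ht, ht'.le⟩ (hb.trans hb'.symm)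
  rfl

noncomputable instance [Finite V] (x : Γ.Point) : Fintype (Γ.Tangent x) := Fintype.ofFinite _

/-! ### Rational functions and divisors -/

variable {Γ}

/-- `f` is affine of slope `m` near `x` in the direction `ν`. -/
def HasSlope (f : Γ.Point → ℝ) {x : Γ.Point} (ν : Γ.Tangent x) (m : ℤ) : Prop :=
  ∀ᶠ h in 𝓝[>] (0 : ℝ), f (Γ.pt ν.dart (ν.pos + h)) = f x + m * h

open Classical in
/-- The outgoing slope of `f` at `x` in the direction `ν` (`0` if there is no integral slope). -/
noncomputable def slope (f : Γ.Point → ℝ) {x : Γ.Point} (ν : Γ.Tangent x) : ℤ :=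
  if h : ∃ m, HasSlope f ν m then h.choose else 0

/-- The order of `f` at `x`, i.e. the coefficient of `div f` at `x`. -/
noncomputable def ord [Finite V] (f : Γ.Point → ℝ) (x : Γ.Point) : ℤ :=
  -∑ ν : Γ.Tangent x, slope f ν

variable (Γ) in
/-- `Rat(Γ)`: the continuous piecewise affine functions with integral slopes. -/
def Rat : Set C(Γ.Point, ℝ) :=
  {f | ∀ e : Γ.graph.Dart, ∃ P : Finset ℝ, ∀ a b : ℝ, 0 ≤ a → a < b → b ≤ Γ.len e →
    (∀ p ∈ P, p ∉ Ioo a b) →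
      ∃ m : ℤ, ∀ t ∈ Icc a b, f (Γ.pt e t) = f (Γ.pt e a) + m * (t - a)}

/-- `Rat(D)`: the rational functions `f` with `D + div f ≥ 0`. -/
def RatD [Finite V] (D : Γ.Point →₀ ℤ) : Set C(Γ.Point, ℝ) :=
  {f | f ∈ Γ.Rat ∧ ∀ x, 0 ≤ D x + ord f x}

/-! ### Slope structures -/

variable (Γ) in
/-- Slope structures of order `r` on `Γ`, defined on the given model: `r + 1` allowed slopes on each
oriented edge, and a rank function at each point, which is the standard one in the interiors of
the edges of the model. -/
structure SlopeStructure [Finite V] (r : ℕ) where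
  slopes : Γ.graph.Dart → Fin (r + 1) → ℤ
  strictMono : ∀ e, StrictMono (slopes e)
  slopes_symm : ∀ e i, slopes e i + slopes e.symm (Fin.rev i) = 0
  rank : ∀ x : Γ.Point, (Γ.Tangent x → Fin (r + 1)) → ℤ
  isRank : ∀ x, IsRankFunction (rank x)
  rank_interior : ∀ (e : Γ.graph.Dart) (t : ℝ), 0 < t → t < Γ.len e →
    rank (Γ.pt e t) = standardRank

variable [Finite V] {r : ℕ}

/-- The slope vector `s_a` at `x` of a point `a` of the hypercube at `x`. -/
def SlopeStructure.vec (S : Γ.SlopeStructure r) {x : Γ.Point} (a : Γ.Tangent x → Fin (r + 1)) :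
    Γ.Tangent x → ℤ :=
  fun ν => S.slopes ν.dart (a ν)

/-- `S^x`: the set of slope vectors at `x` of the jumps of the rank function at `x`. -/
def SlopeStructure.allowed (S : Γ.SlopeStructure r) (x : Γ.Point) : Set (Γ.Tangent x → ℤ) :=
  S.vec '' jumps (S.rank x)

/-- `δ_x(f)`: the vector of outgoing slopes of `f` at `x`. -/
noncomputable def slopeVec (f : Γ.Point → ℝ) (x : Γ.Point) : Γ.Tangent x → ℤ :=
  fun ν => slope f ν

/-- `Rat(D, S)`: the functions in `Rat(D)` that are compatible with the slope structure `S`. -/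
def RatDS (D : Γ.Point →₀ ℤ) (S : Γ.SlopeStructure r) : Set C(Γ.Point, ℝ) :=
  {f | f ∈ RatD D ∧ ∀ x, slopeVec f x ∈ S.allowed x}

/-- `ρ_x(δ_x(f)) ≥ n`, where `δ_x(f)` is identified with the point `a` of the hypercube at `x` for
which it is the slope vector `s_a`. -/
def RankAtLeast (S : Γ.SlopeStructure r) (f : Γ.Point → ℝ) (x : Γ.Point) (n : ℤ) : Prop :=
  ∃ a : Γ.Tangent x → Fin (r + 1), slopeVec f x = S.vec a ∧ n ≤ S.rank x a

/-! ### Linear series -/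

/-- The rank property of a set `M` of rational functions: for every effective divisor `E` of degree
`r` there is `f` in `M` with `ρ_x(δ_x(f)) ≥ E(x)` for all `x` and `D + div f - E ≥ 0`. -/
def RankProperty (D : Γ.Point →₀ ℤ) (S : Γ.SlopeStructure r) (M : Set C(Γ.Point, ℝ)) : Prop :=
  ∀ E : Γ.Point →₀ ℤ, 0 ≤ E → E.degree = (r : ℤ) →
    ∃ f ∈ M, (∀ x, RankAtLeast S f x (E x)) ∧ ∀ x, 0 ≤ D x + ord f x - E x

/-- `(D, S)` is a crude linear series. -/
def IsCrudeLinearSeries (D : Γ.Point →₀ ℤ) (S : Γ.SlopeStructure r) : Prop :=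
  RankProperty D S (RatDS D S)

/-- `M` is a linear series associated to `(D, S)`: a sub-semimodule of `Rat(D, S)` for the
operations `min` and addition of real constants, which is closed in `Rat(D)` for uniform
convergence (the topology of `C(Γ.Point, ℝ)`, as `Γ.Point` is compact) and has the rank property. -/
structure IsLinearSeries (D : Γ.Point →₀ ℤ) (S : Γ.SlopeStructure r)
    (M : Set C(Γ.Point, ℝ)) : Prop where
  subset : M ⊆ RatDS D S
  min_mem : ∀ f ∈ M, ∀ g ∈ M, f ⊓ g ∈ M
  add_const_mem : ∀ f ∈ M, ∀ c : ℝ, f + ContinuousMap.const Γ.Point c ∈ M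
  isClosed : IsClosed ((↑) ⁻¹' M : Set (RatD D))
  rank : RankProperty D S M

/-- The function `f_v`, the pointwise infimum of `g - g(v)` for `g` in `M`. -/
noncomputable def reducedFun (M : Set C(Γ.Point, ℝ)) (v x : Γ.Point) : ℝ :=
  ⨅ g : M, ((g : C(Γ.Point, ℝ)) x - (g : C(Γ.Point, ℝ)) v)

/-- The `v`-reduced divisor `D_v = D + div f_v` with respect to `M`, by its coefficients. -/
noncomputable def reducedDivisor (D : Γ.Point →₀ ℤ) (M : Set C(Γ.Point, ℝ)) (v x : Γ.Point) : ℤ :=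
  D x + ord (reducedFun M v) x

/-- The topology of the symmetric product, as a quotient of the `d`-fold product. -/
instance {d : ℕ} : TopologicalSpace (Sym Γ.Point d) :=
  TopologicalSpace.coinduced
    (fun p : Fin d → Γ.Point => (⟨Multiset.map p Finset.univ.val, by simp⟩ : Sym Γ.Point d))
    inferInstance

open Classical in
/-- The effective divisor `x_1 + ... + x_d` given by a point of the symmetric product, by its
coefficients. -/
noncomputable def symDivisor {d : ℕ} (E : Sym Γ.Point d) (x : Γ.Point) : ℤ :=
  (Multiset.count x (E : Multiset Γ.Point) : ℤ)

/-- The linear system `|M|`, as a subspace of the symmetric product: the effective divisors of the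
form `D + div f` for `f` in `M`. -/
def linearSystem (d : ℕ) (D : Γ.Point →₀ ℤ) (M : Set C(Γ.Point, ℝ)) : Set (Sym Γ.Point d) :=
  {E | ∃ f ∈ M, ∀ x, symDivisor E x = D x + ord f x}

/-- A map on `Γ` is non-contracting if it is not constant on any segment of positive length (every
segment of positive length contains one which lies on an edge). -/
def IsNonContracting {X : Type*} (φ : Γ.Point → X) : Prop :=
  ∀ (e : Γ.graph.Dart) (a b : ℝ), 0 ≤ a → a < b → b ≤ Γ.len e →
    ¬ ∃ c, ∀ t ∈ Icc a b, φ (Γ.pt e t) = c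

end MetricGraph

namespace MetricGraph

variable {V : Type*} {Γ : MetricGraph V}

/-! ### Points and the topology -/

/-! The reduced function. Functions compatible with the slope structure have slopes in a fixed
finite set on each edge, hence a common Lipschitz constant there; as the graph is connected, the
infimum `f_v` is finite, and it is Lipschitz along edges both in `x` and in `v`. Off the support of
`D`, effectivity makes every `g ∈ M` concave along edges, with supporting slopes in a finite set of
integers. This property passes to infima and forces piecewise affinity with integral slopes, so
`f_v` is rational (`reducedMap_mem_rat`). Closure under `min` and compactness make `f_v` a uniform
limit from above of elements of `M`. Concavity and integrality of slopes show that a close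
approximant has outgoing slopes at least those of `f_v`, so `D + div f_v ≥ 0`, and closedness puts
`f_v` in `M`.

Continuity. By Green's identity (`finsum_mul_ord_comm`), the sum of a tent `φ` over the points of
`D_v` is a constant plus `∑ f_v(x) ord_x(φ)`, a finite sum continuous in `v`. A narrow tent at a
point `y` of `D_v` thus shows that nearby divisors keep at least the multiplicity of `y` near `y`;
since all degrees equal `d`, this is closeness in the symmetric product.

Non-contraction. A divisor determines its function up to a constant. If `D_v` is constant on a
segment, the functions `f_v` for `v` there differ by constants, and minimality from both ends of
each subsegment makes all elements of `M` agree up to constants on the segment. For `r ≥ 1` this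
contradicts the rank property at divisors `r · x`, which provides both the smallest and the largest
slope on a common subsegment. -/

theorem pt_zero (e : Γ.graph.Dart) : Γ.pt e 0 = Γ.vtx e.fst :=
  Quot.sound (Glue.tail e _ (by simp))

theorem pt_symm (e : Γ.graph.Dart) {t : ℝ} (ht : t ∈ Icc 0 (Γ.len e)) :
    Γ.pt e.symm (Γ.len e - t) = Γ.pt e t := by
  have h : Γ.len e - t ∈ Icc 0 (Γ.len e.symm) := by
    rw [Γ.len_symm]; exact ⟨by linarith [ht.2], by linarith [ht.1]⟩
  refine (Quot.sound (Glue.flip e _ _ ?_)).symm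
  rw [projIcc_of_mem _ ht, projIcc_of_mem _ h]
  simp

theorem pt_len (e : Γ.graph.Dart) : Γ.pt e (Γ.len e) = Γ.vtx e.snd := by
  have h := pt_symm e (t := Γ.len e) ⟨(Γ.len_pos e).le, le_rfl⟩
  rw [← h, sub_self, pt_zero]
  rfl

theorem point_cases (x : Γ.Point) :
    (∃ v, x = Γ.vtx v) ∨ ∃ e t, 0 < t ∧ t < Γ.len e ∧ x = Γ.pt e t := by
  induction x using Quot.ind with
  | mk p =>
    rcases p with v | ⟨e, t, ht⟩
    · exact Or.inl ⟨v, rfl⟩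
    · have h : Quot.mk Γ.Glue (Sum.inr ⟨e, t, ht⟩) = Γ.pt e t := by
        rw [pt, projIcc_of_mem _ ht]
      rw [h]
      rcases ht.1.eq_or_lt with h0 | h0
      · exact Or.inl ⟨_, by rw [← h0, pt_zero]⟩
      · rcases ht.2.eq_or_lt with h1 | h1
        · exact Or.inl ⟨_, by rw [h1, pt_len]⟩
        · exact Or.inr ⟨e, t, h0, h1, rfl⟩

/-- The coordinate `coordPre e` descends to the quotient. Off `e` and its reversal it only takes the
values `0`, `len e` and `-1`, none of which lies strictly between `0` and `len e`. -/
theorem eq_of_pt_eq_interior {e e' : Γ.graph.Dart} {t t' : ℝ} (h0 : 0 < t) (h1 : t < Γ.len e)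
    (ht' : t' ∈ Icc 0 (Γ.len e')) (h : Γ.pt e' t' = Γ.pt e t) :
    (e' = e ∧ t' = t) ∨ (e' = e.symm ∧ t' = Γ.len e - t) := by
  have h := congrArg (Quot.lift (Γ.coordPre e) (Γ.coordPre_glue e)) h
  simp only [pt, coordPre, projIcc_of_mem _ ht', projIcc_of_mem _ (⟨h0.le, h1.le⟩ : t ∈ Icc _ _),
    if_true] at h
  split_ifs at h with a1 a2
  · exact Or.inl ⟨a1, h⟩
  · exact Or.inr ⟨a2, by linarith⟩
  all_goals exfalso; linarith

theorem continuous_pt (e : Γ.graph.Dart) : Continuous (Γ.pt e) := by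
  let : TopologicalSpace V := ⊥
  let : TopologicalSpace Γ.graph.Dart := ⊥
  have h : Continuous fun t : ℝ =>
      (Sum.inr ⟨e, projIcc 0 (Γ.len e) (Γ.len_pos e).le t⟩ : Γ.Pre) :=
    continuous_inr.comp (continuous_sigmaMk.comp continuous_projIcc)
  exact continuous_quot_mk.comp h

/-- The vertex summand of the disjoint union is discrete, so only the edge intervals impose a
condition. -/
theorem isOpen_point_iff {U : Set Γ.Point} :
    IsOpen U ↔ ∀ e, ∀ t ∈ Icc 0 (Γ.len e), Γ.pt e t ∈ U →
      ∀ᶠ s in 𝓝[Icc 0 (Γ.len e)] t, Γ.pt e s ∈ U := by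
  constructor
  · intro hU e t _ h
    exact ((continuous_pt e).continuousAt.eventually (hU.mem_nhds h)).filter_mono nhdsWithin_le_nhds
  · intro H
    let : TopologicalSpace V := ⊥
    have : DiscreteTopology V := ⟨rfl⟩
    let : TopologicalSpace Γ.graph.Dart := ⊥
    change IsOpen (Quot.mk Γ.Glue ⁻¹' U)
    rw [isOpen_sum_iff, isOpen_sigma_iff]
    refine ⟨isOpen_discrete _, fun e => ?_⟩
    rw [isOpen_iff_mem_nhds]
    rintro ⟨t, ht⟩ h
    have hpt : ∀ s (hs : s ∈ Icc 0 (Γ.len e)),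
        Quot.mk Γ.Glue (Sum.inr ⟨e, s, hs⟩) = Γ.pt e s := fun s hs => by
      rw [pt, projIcc_of_mem _ hs]
    have h2 := H e t ht (by rw [← hpt t ht]; exact h)
    rw [nhdsWithin_eq_map_subtype_coe ht, eventually_map] at h2
    filter_upwards [h2] with s hs
    rw [← hpt s s.2] at hs
    exact hs

theorem continuous_point {Y : Type*} [TopologicalSpace Y] {F : Γ.Point → Y}
    (h : ∀ e, ContinuousOn (fun t => F (Γ.pt e t)) (Icc 0 (Γ.len e))) : Continuous F := by
  refine continuous_def.2 fun U hU => isOpen_point_iff.2 fun e t ht htU => ?_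
  exact (h e t ht).eventually (hU.mem_nhds htU)

/-- Each edge passes through a given point at most once. Hausdorffness is obtained later, from
tents. -/
instance : T1Space Γ.Point := by
  refine ⟨fun y => ⟨isOpen_point_iff.2 fun e t ht hty => ?_⟩⟩
  by_cases h : ∃ s ∈ Icc 0 (Γ.len e), Γ.pt e s = y
  · obtain ⟨s, hs, rfl⟩ := h
    have hts : t ≠ s := by rintro rfl; exact hty rfl
    filter_upwards [nhdsWithin_le_nhds (isOpen_ne.mem_nhds hts), self_mem_nhdsWithin] with s' h1 h2 h3
    exact h1 (Γ.pt_injOn e h2 hs h3)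
  · filter_upwards [self_mem_nhdsWithin] with s hs h3
    exact h ⟨s, hs, h3⟩

/-- A property of points that holds at some point and propagates along edges holds everywhere. -/
theorem point_induction {p : Γ.Point → Prop} {x₀ : Γ.Point} (h₀ : p x₀)
    (step : ∀ e, ∀ s ∈ Icc 0 (Γ.len e), ∀ t ∈ Icc 0 (Γ.len e), p (Γ.pt e s) → p (Γ.pt e t))
    (x : Γ.Point) : p x := by
  have hz : ∀ e : Γ.graph.Dart, (0 : ℝ) ∈ Icc 0 (Γ.len e) := fun e => ⟨le_rfl, (Γ.len_pos e).le⟩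
  have hl : ∀ e : Γ.graph.Dart, Γ.len e ∈ Icc 0 (Γ.len e) := fun e => ⟨(Γ.len_pos e).le, le_rfl⟩
  obtain ⟨v₀, hv₀⟩ : ∃ v, p (Γ.vtx v) := by
    rcases point_cases x₀ with ⟨v, rfl⟩ | ⟨e, t, h0, h1, rfl⟩
    · exact ⟨v, h₀⟩
    · exact ⟨e.fst, by rw [← pt_zero]; exact step e t ⟨h0.le, h1.le⟩ 0 (hz e) h₀⟩
  have hv : ∀ v, p (Γ.vtx v) := by
    intro v
    obtain ⟨w⟩ := Γ.connected.preconnected v₀ v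
    induction w with
    | nil => exact hv₀
    | cons hadj _ ih =>
      refine ih ?_
      have h := step ⟨(_, _), hadj⟩ 0 (hz _) _ (hl _)
      rw [pt_zero, pt_len] at h
      exact h hv₀
  rcases point_cases x with ⟨v, rfl⟩ | ⟨e, t, h0, h1, rfl⟩
  · exact hv v
  · exact step e 0 (hz e) t ⟨h0.le, h1.le⟩ (by rw [pt_zero]; exact hv _)

/-- A nonempty clopen set of points, given by its intersections with the edges, is everything. -/
theorem eq_univ_of_isClopen {Z : Set Γ.Point} (hZ : IsClopen Z) {x₀ : Γ.Point} (h₀ : x₀ ∈ Z)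
    (x : Γ.Point) : x ∈ Z := by
  refine point_induction (p := (· ∈ Z)) h₀ (fun e s hs t ht h => ?_) x
  -- Clamping makes `pt e` continuous on the whole connected line.
  have h2 : IsClopen (Γ.pt e ⁻¹' Z) := hZ.preimage (continuous_pt e)
  rcases isClopen_iff.1 h2 with h3 | h3
  · exact absurd (show s ∈ Γ.pt e ⁻¹' Z from h) (by simp [h3])
  · exact (h3 ▸ mem_univ t : t ∈ Γ.pt e ⁻¹' Z)

instance [Finite V] : Finite Γ.graph.Dart := Finite.of_injective _ SimpleGraph.Dart.toProd_injective

/-! ### Slopes along oriented edges -/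

/-- `f` is affine of slope `m` near the point at distance `t` on `e`, in the direction of `e`. -/
def HasEdgeSlope (f : Γ.Point → ℝ) (e : Γ.graph.Dart) (t : ℝ) (m : ℤ) : Prop :=
  ∀ᶠ h in 𝓝[>] (0 : ℝ), f (Γ.pt e (t + h)) = f (Γ.pt e t) + m * h

theorem HasEdgeSlope.unique {f : Γ.Point → ℝ} {e : Γ.graph.Dart} {t : ℝ} {m m' : ℤ}
    (h : HasEdgeSlope f e t m) (h' : HasEdgeSlope f e t m') : m = m' := by
  obtain ⟨s, hs, h1, h2⟩ := ((eventually_mem_nhdsWithin (a := (0 : ℝ)) (s := Ioi 0)).and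
    (h.and h')).exists
  have h3 : (m : ℝ) * s = m' * s := by linarith
  exact_mod_cast mul_right_cancel₀ (ne_of_gt hs) h3

open Classical in
/-- The slope of `f` at distance `t` on `e` in the direction of `e`. -/
noncomputable def edgeSlope (f : Γ.Point → ℝ) (e : Γ.graph.Dart) (t : ℝ) : ℤ :=
  if h : ∃ m, HasEdgeSlope f e t m then h.choose else 0

theorem HasEdgeSlope.edgeSlope_eq {f : Γ.Point → ℝ} {e : Γ.graph.Dart} {t : ℝ} {m : ℤ}
    (h : HasEdgeSlope f e t m) : edgeSlope f e t = m := by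
  have h' : ∃ m, HasEdgeSlope f e t m := ⟨m, h⟩
  rw [edgeSlope, dif_pos h']
  exact h'.choose_spec.unique h

/-- Once `x` is replaced by the base point of `ν`, both sides unfold to the same expression. The
right-hand side no longer depends on the tangent type, so slopes at different points can be
compared. -/
theorem slope_eq_edgeSlope (f : Γ.Point → ℝ) {x : Γ.Point} (ν : Γ.Tangent x) :
    slope f ν = edgeSlope f ν.dart ν.pos := by
  obtain ⟨e, t, h0, h1, rfl⟩ := ν
  rfl

theorem hasEdgeSlope_of_affine {f : Γ.Point → ℝ} {e : Γ.graph.Dart} {a b : ℝ} {m : ℤ} (hab : a < b)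
    (h : ∀ t ∈ Icc a b, f (Γ.pt e t) = f (Γ.pt e a) + m * (t - a)) : HasEdgeSlope f e a m := by
  have : Ioo 0 (b - a) ∈ 𝓝[>] (0 : ℝ) := Ioo_mem_nhdsGT (by linarith)
  filter_upwards [this] with s hs
  rw [h (a + s) ⟨by linarith [hs.1], by linarith [hs.2]⟩]
  ring

theorem hasEdgeSlope_symm_of_affine {f : Γ.Point → ℝ} {e : Γ.graph.Dart} {a b : ℝ} {m : ℤ}
    (ha : 0 ≤ a) (hab : a < b) (hb : b ≤ Γ.len e)
    (h : ∀ t ∈ Icc a b, f (Γ.pt e t) = f (Γ.pt e a) + m * (t - a)) :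
    HasEdgeSlope f e.symm (Γ.len e - b) (-m) := by
  have : Ioo 0 (b - a) ∈ 𝓝[>] (0 : ℝ) := Ioo_mem_nhdsGT (by linarith)
  filter_upwards [this] with s hs
  have e1 : Γ.len e - b + s = Γ.len e - (b - s) := by ring
  rw [e1, pt_symm e ⟨by linarith [hs.2], by linarith [hs.1]⟩, pt_symm e ⟨by linarith, hb⟩,
    h (b - s) ⟨by linarith [hs.2], by linarith [hs.1]⟩, h b ⟨hab.le, le_rfl⟩]
  push_cast
  ring

/-- Restriction of affinity to a subinterval. -/
theorem affine_mono {u : ℝ → ℝ} {a b a' b' m : ℝ} (h : ∀ t ∈ Icc a b, u t = u a + m * (t - a))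
    (ha : a ≤ a') (hb : b' ≤ b) : ∀ t ∈ Icc a' b', u t = u a' + m * (t - a') := by
  intro t ht
  rw [h t ⟨ha.trans ht.1, ht.2.trans hb⟩, h a' ⟨ha, ht.1.trans (ht.2.trans hb)⟩]
  ring

theorem eventually_notMem_Ioo (P : Finset ℝ) (a : ℝ) :
    ∀ᶠ b in 𝓝[>] a, ∀ p ∈ P, p ∉ Ioo a b := by
  rw [eventually_all_finset]
  intro p _
  rcases le_or_gt p a with h | h
  · exact Eventually.of_forall fun b hb => absurd hb.1 (not_lt.2 h)
  · filter_upwards [Ioo_mem_nhdsGT h] with b hb hp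
    exact absurd hb.2 (not_lt.2 hp.2.le)

theorem Rat.exists_affine {f : C(Γ.Point, ℝ)} (hf : f ∈ Γ.Rat) (e : Γ.graph.Dart) {a c : ℝ}
    (h0 : 0 ≤ a) (hac : a < c) (hc : c ≤ Γ.len e) :
    ∃ b, a < b ∧ b < c ∧ ∀ t ∈ Icc a b, f (Γ.pt e t) = f (Γ.pt e a) + edgeSlope f e a * (t - a) := by
  obtain ⟨P, hP⟩ := hf e
  obtain ⟨b, hb, hb2⟩ := ((eventually_notMem_Ioo P a).and (Ioo_mem_nhdsGT hac)).exists
  obtain ⟨m, hm⟩ := hP a b h0 hb2.1 (hb2.2.le.trans hc) hb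
  have := (hasEdgeSlope_of_affine hb2.1 hm).edgeSlope_eq
  exact ⟨b, hb2.1, hb2.2, by rw [this]; exact hm⟩

theorem Rat.hasEdgeSlope {f : C(Γ.Point, ℝ)} (hf : f ∈ Γ.Rat) {e : Γ.graph.Dart} {a : ℝ}
    (h0 : 0 ≤ a) (hl : a < Γ.len e) : HasEdgeSlope f e a (edgeSlope f e a) := by
  obtain ⟨b, hab, _, h⟩ := Rat.exists_affine hf e h0 hl le_rfl
  exact hasEdgeSlope_of_affine hab h

/-- Affinity near `b` on the left. -/
theorem Rat.exists_affine_left {f : C(Γ.Point, ℝ)} (hf : f ∈ Γ.Rat) (e : Γ.graph.Dart) {c b : ℝ}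
    (h0 : 0 ≤ c) (hcb : c < b) (hl : b ≤ Γ.len e) :
    ∃ a, c < a ∧ a < b ∧ ∀ t ∈ Icc a b,
      f (Γ.pt e t) = f (Γ.pt e b) - edgeSlope f e.symm (Γ.len e - b) * (t - b) := by
  obtain ⟨a, h1, h2, h⟩ := Rat.exists_affine hf e.symm (a := Γ.len e - b) (c := Γ.len e - c)
    (by linarith) (by linarith) (by rw [Γ.len_symm]; linarith)
  refine ⟨Γ.len e - a, by linarith, by linarith, fun t ht => ?_⟩
  have := h (Γ.len e - t) ⟨by linarith [ht.2], by linarith [ht.1]⟩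
  rw [pt_symm e ⟨by linarith [ht.1], by linarith [ht.2]⟩, pt_symm e ⟨by linarith, hl⟩] at this
  rw [this]
  ring

/-- A property of intervals that holds for intervals without a break point in their interior and can
be glued at break points holds for all intervals. -/
theorem interval_induction (P : Finset ℝ) {Q : ℝ → ℝ → Prop}
    (base : ∀ a b, a < b → (∀ p ∈ P, p ∉ Ioo a b) → Q a b)
    (glue : ∀ a p b, a < p → p < b → p ∈ P → Q a p → Q p b → Q a b) {a b : ℝ} (hab : a < b) :
    Q a b := by
  -- Induction on the number of break points inside the interval: cutting at `p` removes `p` from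
  -- both halves.
  induction hn : (P.filter (· ∈ Ioo a b)).card using Nat.strong_induction_on generalizing a b with
  | _ n ih =>
    by_cases h : ∀ p ∈ P, p ∉ Ioo a b
    · exact base a b hab h
    · push Not at h
      obtain ⟨p, hpP, hp⟩ := h
      refine glue a p b hp.1 hp.2 hpP (ih _ ?_ hp.1 rfl) (ih _ ?_ hp.2 rfl)
      all_goals
        rw [← hn]
        refine Finset.card_lt_card (Finset.ssubset_iff_of_subset ?_ |>.2
          ⟨p, by simp [hpP, hp.1, hp.2], by simp⟩)
        intro q hq
        simp only [Finset.mem_filter, mem_Ioo] at hq ⊢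
      · exact ⟨hq.1, hq.2.1, hq.2.2.trans hp.2⟩
      · exact ⟨hq.1, hp.1.trans hq.2.1, hq.2.2⟩

variable [Finite V]

theorem sum_tangent_interior (G : Γ.graph.Dart → ℝ → ℤ) {e : Γ.graph.Dart} {t : ℝ} (h0 : 0 < t)
    (h1 : t < Γ.len e) : ∑ ν : Γ.Tangent (Γ.pt e t), G ν.dart ν.pos =
      G e t + G e.symm (Γ.len e - t) := by
  classical
  let ν₁ : Γ.Tangent (Γ.pt e t) := ⟨e, t, h0.le, h1, rfl⟩
  let ν₂ : Γ.Tangent (Γ.pt e t) := ⟨e.symm, Γ.len e - t, by linarith,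
    by rw [Γ.len_symm]; linarith, pt_symm e ⟨h0.le, h1.le⟩⟩
  have hne : ν₁ ≠ ν₂ := fun h => SimpleGraph.Dart.symm_ne e (congrArg Tangent.dart h).symm
  have hu : (Finset.univ : Finset (Γ.Tangent (Γ.pt e t))) = {ν₁, ν₂} := by
    refine (Finset.eq_univ_of_forall fun ν => ?_).symm
    rcases eq_of_pt_eq_interior h0 h1 ⟨ν.pos_nonneg, ν.pos_lt.le⟩ ν.base with h | h
    · have : ν = ν₁ := Tangent.ext h.1 h.2
      simp [this]
    · have : ν = ν₂ := Tangent.ext h.1 h.2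
      simp [this]
  rw [hu, Finset.sum_pair hne]

theorem ord_eq (f : Γ.Point → ℝ) (x : Γ.Point) :
    ord f x = -∑ ν : Γ.Tangent x, edgeSlope f ν.dart ν.pos := by
  simp [ord, slope_eq_edgeSlope]

theorem ord_interior (f : Γ.Point → ℝ) {e : Γ.graph.Dart} {t : ℝ} (h0 : 0 < t)
    (h1 : t < Γ.len e) : ord f (Γ.pt e t) =
      -(edgeSlope f e t + edgeSlope f e.symm (Γ.len e - t)) := by
  rw [ord_eq, sum_tangent_interior _ h0 h1]

end MetricGraph

/-! ### Concave functions with finitely many integral slopes -/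

/-- At every point of `[a, b]`, the function `u` has a supporting line from above whose slope lies in
the finite set `F` of integers. -/
def IntegralConcave (F : Finset ℤ) (u : ℝ → ℝ) (a b : ℝ) : Prop :=
  ∀ s ∈ Icc a b, ∃ m ∈ F, ∀ t ∈ Icc a b, u t ≤ u s + m * (t - s)

namespace IntegralConcave

variable {F : Finset ℤ} {u : ℝ → ℝ} {a b : ℝ}

/-- A line supporting `u` at the midpoint of an affine piece must contain that piece. -/
theorem le_of_affine (hu : IntegralConcave F u a b) {c d : ℝ} {m : ℤ} (hac : a ≤ c) (hcd : c < d)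
    (hdb : d ≤ b) (h : ∀ t ∈ Icc c d, u t = u c + m * (t - c)) :
    m ∈ F ∧ ∀ t ∈ Icc a b, u t ≤ u c + m * (t - c) := by
  obtain ⟨k, hkF, hk⟩ := hu ((c + d) / 2) ⟨by linarith, by linarith⟩
  have h1 := h ((c + d) / 2) ⟨by linarith, by linarith⟩
  have h2 := h d ⟨hcd.le, le_rfl⟩
  have h3 := hk d ⟨by linarith, hdb⟩
  have h4 := hk c ⟨hac, by linarith⟩
  have h5 : (k : ℝ) = m := by
    apply le_antisymm <;> by_contra! h6
    · nlinarith
    · nlinarith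
  obtain rfl : k = m := by exact_mod_cast h5
  refine ⟨hkF, fun t ht => ?_⟩
  have := hk t ht
  rw [h1] at this
  linarith

theorem of_affine {m : ℤ} (hm : m ∈ F) (h : ∀ t ∈ Icc a b, u t = u a + m * (t - a)) :
    IntegralConcave F u a b := fun s hs => ⟨m, hm, fun t ht => by rw [h t ht, h s hs]; linarith⟩

/-- Concavity can be checked locally. -/
theorem glue {p a' b' : ℝ} {m₁ m₂ : ℤ} (h₁ : IntegralConcave F u a p)
    (h₂ : IntegralConcave F u p b) (haa : a ≤ a') (hap : a' < p) (hpb : p < b') (hbb : b' ≤ b)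
    (hl : ∀ t ∈ Icc a' p, u t = u p + m₁ * (t - p))
    (hr : ∀ t ∈ Icc p b', u t = u p + m₂ * (t - p)) (hm : m₂ ≤ m₁) :
    IntegralConcave F u a b := by
  have hm' : (m₂ : ℝ) ≤ m₁ := by exact_mod_cast hm
  -- The affine pieces next to `p` extend to supporting lines of slope `m₁` on `[a, p]` and `m₂` on
  -- `[p, b]`. A supporting line at `s < p` has slope at least `m₁ ≥ m₂`, so beyond `p` it stays
  -- above the second line; the case `s > p` is symmetric.
  obtain ⟨-, hl2⟩ := h₁.le_of_affine (m := m₁) haa hap le_rfl fun t ht => by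
    rw [hl t ht, hl a' ⟨le_rfl, hap.le⟩]; ring
  have hl3 : ∀ t ∈ Icc a p, u t ≤ u p + m₁ * (t - p) := fun t ht => by
    have := hl2 t ht
    rw [hl a' ⟨le_rfl, hap.le⟩] at this
    linarith
  obtain ⟨hm2F, hr2⟩ := h₂.le_of_affine le_rfl hpb hbb hr
  intro s hs
  rcases lt_trichotomy s p with h | rfl | h
  · obtain ⟨m, hmF, hms⟩ := h₁ s ⟨hs.1, h.le⟩
    have h3 := hl3 s ⟨hs.1, h.le⟩
    have h4 := hms p ⟨by linarith, le_rfl⟩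
    have h5 : (m₁ : ℝ) ≤ m := by by_contra! h6; nlinarith
    refine ⟨m, hmF, fun t ht => ?_⟩
    rcases le_total t p with h6 | h6
    · exact hms t ⟨ht.1, h6⟩
    · have h7 := hr2 t ⟨h6, ht.2⟩
      have h8 : (m₂ : ℝ) * (t - p) ≤ m * (t - p) :=
        mul_le_mul_of_nonneg_right (by linarith) (by linarith)
      linarith
  · refine ⟨m₂, hm2F, fun t ht => ?_⟩
    rcases le_total t s with h6 | h6
    · have h7 := hl3 t ⟨ht.1, h6⟩
      have h8 : (m₁ : ℝ) * (t - s) ≤ m₂ * (t - s) :=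
        mul_le_mul_of_nonpos_right hm' (by linarith)
      linarith
    · exact hr2 t ⟨h6, ht.2⟩
  · obtain ⟨m, hmF, hms⟩ := h₂ s ⟨h.le, hs.2⟩
    have h3 := hr2 s ⟨h.le, hs.2⟩
    have h4 := hms p ⟨le_rfl, by linarith⟩
    have h5 : (m : ℝ) ≤ m₂ := by by_contra! h6; nlinarith
    refine ⟨m, hmF, fun t ht => ?_⟩
    rcases le_total t p with h6 | h6
    · have h7 := hl3 t ⟨ht.1, h6⟩
      have h8 : (m₁ : ℝ) * (t - p) ≤ m * (t - p) :=
        mul_le_mul_of_nonpos_right (by linarith) (by linarith)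
      linarith
    · exact hms t ⟨h6, ht.2⟩

/-- Such functions are stable under infima. -/
theorem of_approx (h : ∀ s ∈ Icc a b, ∀ ε > 0, ∃ w, IntegralConcave F w a b ∧
    (∀ t ∈ Icc a b, u t ≤ w t) ∧ w s < u s + ε) : IntegralConcave F u a b := by
  intro s hs
  by_contra! hc
  -- Each candidate slope `m` fails at some point `τ m` by a positive amount. As `F` is finite, one
  -- `ε` is smaller than all these gaps, and an approximant within `ε` at `s` has a supporting slope
  -- in `F` that cannot fail.
  choose! τ hτ hlt using hc
  have h1 : ∀ᶠ ε in 𝓝[>] (0 : ℝ), ∀ m ∈ F, ε < u (τ m) - (u s + m * (τ m - s)) := by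
    rw [eventually_all_finset]
    intro m hm
    filter_upwards [Ioo_mem_nhdsGT (sub_pos.2 (hlt m hm))] with ε hε using hε.2
  obtain ⟨ε, hε, hε0⟩ := (h1.and self_mem_nhdsWithin).exists
  obtain ⟨w, hw, huw, hws⟩ := h s hs ε hε0
  obtain ⟨m, hmF, hm⟩ := hw s hs
  have h2 := hε m hmF
  have h3 := hm _ (hτ m hmF)
  have h4 := huw _ (hτ m hmF)
  linarith

/-- For `m ∈ F` let `A m` be the set of points where a line of slope `m` supports `u`. Strictly
between two points of `A m`, `u` is affine of slope `m`, so the infima and suprema of these sets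
serve as break points. They need not be known to be attained: continuity extends the formula to
closed intervals. -/
theorem exists_breakpoints (hu : IntegralConcave F u a b) (hc : Continuous u) :
    ∃ P : Finset ℝ, ∀ a' b', a ≤ a' → a' < b' → b' ≤ b → (∀ p ∈ P, p ∉ Ioo a' b') →
      ∃ m : ℤ, ∀ t ∈ Icc a' b', u t = u a' + m * (t - a') := by
  classical
  let A : ℤ → Set ℝ := fun m => {s | s ∈ Icc a b ∧ ∀ t ∈ Icc a b, u t ≤ u s + m * (t - s)}
  have hbb : ∀ m, BddBelow (A m) := fun m => ⟨a, fun s hs => hs.1.1⟩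
  have hba : ∀ m, BddAbove (A m) := fun m => ⟨b, fun s hs => hs.1.2⟩
  refine ⟨F.image (fun m => sInf (A m)) ∪ F.image (fun m => sSup (A m)), ?_⟩
  intro a' b' haa hab hb' hP
  have hx : (a' + b') / 2 ∈ Icc a b := ⟨by linarith, by linarith⟩
  obtain ⟨m, hmF, hm⟩ := hu _ hx
  have hxA : (a' + b') / 2 ∈ A m := ⟨hx, hm⟩
  have h1 : sInf (A m) ≤ a' := by
    by_contra! h
    refine hP (sInf (A m)) (Finset.mem_union_left _ (Finset.mem_image_of_mem _ hmF)) ⟨h, ?_⟩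
    have := csInf_le (hbb m) hxA
    linarith
  have h2 : b' ≤ sSup (A m) := by
    by_contra! h
    refine hP (sSup (A m)) (Finset.mem_union_right _ (Finset.mem_image_of_mem _ hmF)) ⟨?_, h⟩
    have := le_csSup (hba m) hxA
    linarith
  have key : EqOn u (fun t => u ((a' + b') / 2) + m * (t - (a' + b') / 2)) (Ioo a' b') := by
    intro t ht
    obtain ⟨s₁, hs₁, hs₁t⟩ := exists_lt_of_csInf_lt ⟨_, hxA⟩ (h1.trans_lt ht.1)
    obtain ⟨s₂, hs₂, hs₂t⟩ := exists_lt_of_lt_csSup ⟨_, hxA⟩ (ht.2.trans_le h2)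
    have htI : t ∈ Icc a b := ⟨by linarith [ht.1], by linarith [ht.2]⟩
    obtain ⟨k, -, hk⟩ := hu t htI
    have e1 := hk s₁ hs₁.1
    have e2 := hk s₂ hs₂.1
    have e3 := hs₁.2 _ hx
    have e4 := hs₂.2 _ hx
    have e5 := hm _ htI
    refine le_antisymm e5 ?_
    -- For the lower bound, compare at the contact point on the side where the line of slope `k`
    -- through `t` lies below the one of slope `m`.
    rcases le_total (m : ℝ) k with h | h
    · have : ((k : ℝ) - m) * (s₁ - t) ≤ 0 :=
        mul_nonpos_of_nonneg_of_nonpos (by linarith) (by linarith)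
      change u _ + m * (t - _) ≤ _
      linarith
    · have : ((k : ℝ) - m) * (s₂ - t) ≤ 0 :=
        mul_nonpos_of_nonpos_of_nonneg (by linarith) (by linarith)
      change u _ + m * (t - _) ≤ _
      linarith
  have key2 := key.closure hc (by fun_prop)
  rw [closure_Ioo hab.ne] at key2
  refine ⟨m, fun t ht => ?_⟩
  have e1 := key2 ht
  have e2 := key2 (⟨le_rfl, hab.le⟩ : a' ∈ Icc a' b')
  simp only at e1 e2
  rw [e1, e2]
  ring

end IntegralConcave

/-! ### Concavity and Lipschitz bounds from the slope structure. -/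

namespace MetricGraph

variable {V : Type*} {Γ : MetricGraph V} [Finite V] {r : ℕ} {D : Γ.Point →₀ ℤ}
  {S : Γ.SlopeStructure r}

/-- The finite set of slopes allowed on an oriented edge. -/
def SlopeStructure.slopeSet (S : Γ.SlopeStructure r) (e : Γ.graph.Dart) : Finset ℤ :=
  Finset.univ.image (S.slopes e)

theorem edgeSlope_mem_slopeSet {f : C(Γ.Point, ℝ)} (hf : f ∈ RatDS D S) {e : Γ.graph.Dart} {t : ℝ}
    (h0 : 0 ≤ t) (h1 : t < Γ.len e) : edgeSlope f e t ∈ S.slopeSet e := by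
  obtain ⟨a, -, ha⟩ := hf.2 (Γ.pt e t)
  have h : S.slopes e (a ⟨e, t, h0, h1, rfl⟩) = edgeSlope f e t :=
    (congrFun ha ⟨e, t, h0, h1, rfl⟩).trans (slope_eq_edgeSlope _ _)
  rw [← h]
  exact Finset.mem_image_of_mem _ (Finset.mem_univ _)

/-- Where `D` vanishes, effectivity at a break point says that the two outgoing slopes have sum at
most `0`, i.e. the slope does not increase through it. Between break points the slope is one of the
allowed ones. -/
theorem integralConcave_of_mem {f : C(Γ.Point, ℝ)} (hf : f ∈ RatDS D S) (e : Γ.graph.Dart)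
    {a b : ℝ} (h0 : 0 ≤ a) (hab : a < b) (h1 : b ≤ Γ.len e)
    (hD : ∀ t ∈ Ioo a b, D (Γ.pt e t) = 0) :
    IntegralConcave (S.slopeSet e) (fun t => f (Γ.pt e t)) a b := by
  obtain ⟨P, hP⟩ := hf.1.1 e
  refine interval_induction P (Q := fun a' b' => a ≤ a' → b' ≤ b →
    IntegralConcave (S.slopeSet e) (fun t => f (Γ.pt e t)) a' b') ?_ ?_ hab le_rfl le_rfl
  · intro a' b' hab' hp ha hb
    obtain ⟨m, hm⟩ := hP a' b' (h0.trans ha) hab' (hb.trans h1) hp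
    refine IntegralConcave.of_affine ?_ hm
    rw [← (hasEdgeSlope_of_affine hab' hm).edgeSlope_eq]
    exact edgeSlope_mem_slopeSet hf (h0.trans ha) (by linarith)
  · intro a' p b' hap hpb _ hQ₁ hQ₂ ha hb
    obtain ⟨c, hc1, hc2, hc⟩ := Rat.exists_affine_left hf.1.1 e (h0.trans ha) hap (by linarith)
    obtain ⟨d, hd1, hd2, hd⟩ := Rat.exists_affine hf.1.1 e (a := p) (c := b') (by linarith) hpb
      (by linarith)
    refine (hQ₁ ha (by linarith)).glue (hQ₂ (by linarith) hb) hc1.le hc2 hd1 hd2.le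
      (m₁ := -edgeSlope f e.symm (Γ.len e - p)) (fun t ht => ?_) hd ?_
    · have := hc t ht
      push_cast
      linarith
    · have h2 := hf.1.2 (Γ.pt e p)
      rw [ord_interior _ (by linarith) (by linarith), hD p ⟨by linarith, by linarith⟩] at h2
      linarith

/-- A common Lipschitz constant on an edge for all functions compatible with a slope structure. -/
theorem exists_lipschitz (S : Γ.SlopeStructure r) (e : Γ.graph.Dart) :
    ∃ L : ℝ, 0 < L ∧ ∀ (D : Γ.Point →₀ ℤ), ∀ f ∈ RatDS D S, ∀ s ∈ Icc 0 (Γ.len e),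
      ∀ t ∈ Icc 0 (Γ.len e), |f (Γ.pt e s) - f (Γ.pt e t)| ≤ L * |s - t| := by
  -- The sum of the absolute values bounds every allowed slope, and the summand `1` makes the
  -- constant positive.
  refine ⟨∑ m ∈ S.slopeSet e, |(m : ℝ)| + 1,
    add_pos_of_nonneg_of_pos (Finset.sum_nonneg fun _ _ => abs_nonneg _) one_pos, ?_⟩
  intro D f hf
  set L := ∑ m ∈ S.slopeSet e, |(m : ℝ)| + 1
  have key : ∀ a b, a < b → 0 ≤ a → b ≤ Γ.len e →
      |f (Γ.pt e b) - f (Γ.pt e a)| ≤ L * (b - a) := by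
    obtain ⟨P, hP⟩ := hf.1.1 e
    refine fun a b hab => interval_induction P (Q := fun a b => 0 ≤ a → b ≤ Γ.len e →
      |f (Γ.pt e b) - f (Γ.pt e a)| ≤ L * (b - a)) ?_ ?_ hab
    · intro a b hab hp h0 h1
      obtain ⟨m, hm⟩ := hP a b h0 hab h1 hp
      have hmF : m ∈ S.slopeSet e := by
        rw [← (hasEdgeSlope_of_affine hab hm).edgeSlope_eq]
        exact edgeSlope_mem_slopeSet hf h0 (by linarith)
      have h2 : |(m : ℝ)| ≤ L :=
        (Finset.single_le_sum (f := fun m : ℤ => |(m : ℝ)|) (fun _ _ => abs_nonneg _) hmF).trans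
          (by simp [L])
      rw [hm b ⟨hab.le, le_rfl⟩, add_sub_cancel_left, abs_mul, abs_of_pos (sub_pos.2 hab)]
      exact mul_le_mul_of_nonneg_right h2 (by linarith)
    · intro a p b hap hpb _ h1 h2 h3 h4
      have h5 := h1 h3 (by linarith)
      have h6 := h2 (by linarith) h4
      have h7 := abs_sub_le (f (Γ.pt e b)) (f (Γ.pt e p)) (f (Γ.pt e a))
      linarith
  intro s hs t ht
  rcases lt_trichotomy s t with h | rfl | h
  · rw [abs_sub_comm, abs_sub_comm s t, abs_of_pos (sub_pos.2 h)]
    exact key s t h hs.1 ht.2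
  · simp
  · rw [abs_of_pos (sub_pos.2 h)]
    exact key t s h ht.1 hs.2

end MetricGraph

namespace MetricGraph

variable {V : Type*} {Γ : MetricGraph V} [Finite V] {r : ℕ} {D : Γ.Point →₀ ℤ}
  {S : Γ.SlopeStructure r} {M : Set C(Γ.Point, ℝ)}

/-! ### Reduced functions -/

/-- The Lipschitz constants do not depend on `g`, so a bound propagates along edges. It makes the
infimum defining `f_v` finite. -/
theorem exists_bound (S : Γ.SlopeStructure r) (D : Γ.Point →₀ ℤ) (v x : Γ.Point) :
    ∃ C, ∀ g ∈ RatDS D S, |g x - g v| ≤ C := by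
  refine point_induction (p := fun x => ∃ C, ∀ g ∈ RatDS D S, |g x - g v| ≤ C) (x₀ := v)
    ⟨0, by simp⟩ ?_ x
  rintro e s hs t ht ⟨C, hC⟩
  obtain ⟨L, -, hL⟩ := exists_lipschitz S e
  refine ⟨L * |t - s| + C, fun g hg => ?_⟩
  have h1 := hL D g hg t ht s hs
  have h2 := hC g hg
  have h3 := abs_sub_le (g (Γ.pt e t)) (g (Γ.pt e s)) (g v)
  linarith

namespace IsLinearSeries

variable (hM : IsLinearSeries D S M)

include hM

theorem nonempty (x : Γ.Point) : M.Nonempty := by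
  obtain ⟨f, hf, -⟩ := hM.rank (Finsupp.single x (r : ℤ)) (by simp) (by simp)
  exact ⟨f, hf⟩

theorem bddBelow (v x : Γ.Point) : BddBelow (Set.range fun g : M =>
    (g : C(Γ.Point, ℝ)) x - (g : C(Γ.Point, ℝ)) v) := by
  obtain ⟨C, hC⟩ := exists_bound S D v x
  refine ⟨-C, ?_⟩
  rintro _ ⟨g, rfl⟩
  exact (abs_le.1 (hC g (hM.subset g.2))).1

theorem reducedFun_le {g : C(Γ.Point, ℝ)} (hg : g ∈ M) (v x : Γ.Point) :
    reducedFun M v x ≤ g x - g v := ciInf_le (hM.bddBelow v x) ⟨g, hg⟩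

theorem reducedFun_self (v : Γ.Point) : reducedFun M v v = 0 := by
  have : Nonempty M := (hM.nonempty v).to_subtype
  simp [reducedFun]

theorem exists_lt_reducedFun_add (v x : Γ.Point) {ε : ℝ} (hε : 0 < ε) :
    ∃ g ∈ M, g v = 0 ∧ (∀ y, reducedFun M v y ≤ g y) ∧ g x < reducedFun M v x + ε := by
  have : Nonempty M := (hM.nonempty v).to_subtype
  obtain ⟨⟨g, hg⟩, h⟩ := exists_lt_of_ciInf_lt (lt_add_of_pos_right (reducedFun M v x) hε)
  refine ⟨_, hM.add_const_mem g hg (-g v), by simp, fun y => ?_, ?_⟩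
  · simpa [sub_eq_add_neg] using hM.reducedFun_le hg v y
  · simpa [sub_eq_add_neg] using h

/-- Test with a nearly optimal `g` for `(w, y)`. This transfers Lipschitz bounds on `M` to the
infimum, in the variable as well as in the base point. -/
theorem reducedFun_sub_le {v w x y : Γ.Point} {C : ℝ}
    (h : ∀ g ∈ M, (g x - g v) - (g y - g w) ≤ C) : reducedFun M v x - reducedFun M w y ≤ C := by
  refine le_of_forall_pos_le_add fun ε hε => ?_
  obtain ⟨g, hg, h0, -, h1⟩ := hM.exists_lt_reducedFun_add w y hε
  have h2 := hM.reducedFun_le hg v x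
  have h3 := h g hg
  linarith

theorem continuous_reducedFun (v : Γ.Point) : Continuous (reducedFun M v) := by
  refine continuous_point fun e => ?_
  obtain ⟨L, hL0, hL⟩ := exists_lipschitz S e
  refine LipschitzOnWith.continuousOn (K := L.toNNReal) (LipschitzOnWith.of_le_add_mul _ ?_)
  intro s hs t ht
  have := hM.reducedFun_sub_le (v := v) (w := v) (x := Γ.pt e s) (y := Γ.pt e t)
    (C := L * |s - t|) fun g hg => by
      have := (abs_le.1 (hL D g (hM.subset hg) s hs t ht)).2
      linarith
  rw [Real.dist_eq, Real.coe_toNNReal _ hL0.le]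
  linarith

theorem continuous_reducedFun_left (x : Γ.Point) : Continuous fun v => reducedFun M v x := by
  refine continuous_point fun e => ?_
  obtain ⟨L, hL0, hL⟩ := exists_lipschitz S e
  refine LipschitzOnWith.continuousOn (K := L.toNNReal) (LipschitzOnWith.of_le_add_mul _ ?_)
  intro s hs t ht
  have := hM.reducedFun_sub_le (v := Γ.pt e s) (w := Γ.pt e t) (x := x) (y := x)
    (C := L * |s - t|) fun g hg => by
      have := (abs_le.1 (hL D g (hM.subset hg) s hs t ht)).1
      linarith
  rw [Real.dist_eq, Real.coe_toNNReal _ hL0.le]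
  linarith

/-- Uniform approximation of the reduced function by elements of `M`. -/
theorem exists_approx (v : Γ.Point) {ε : ℝ} (hε : 0 < ε) :
    ∃ h ∈ M, ∀ x, reducedFun M v x ≤ h x ∧ h x < reducedFun M v x + ε := by
  suffices H : ∃ h ∈ M, (∀ x, reducedFun M v x ≤ h x) ∧
      ∀ x ∈ (univ : Set Γ.Point), h x < reducedFun M v x + ε by
    obtain ⟨h, hm, h1, h2⟩ := H
    exact ⟨h, hm, fun x => ⟨h1 x, h2 x trivial⟩⟩
  -- By continuity, an element of `M` that is `ε`-close at a point is so nearby; a minimum of two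
  -- elements serves both of their sets and still lies above `f_v`.
  refine isCompact_univ.induction_on (p := fun s => ∃ h ∈ M, (∀ x, reducedFun M v x ≤ h x) ∧
      ∀ x ∈ s, h x < reducedFun M v x + ε) ?_ ?_ ?_ ?_
  · obtain ⟨g, hg, -, h, -⟩ := hM.exists_lt_reducedFun_add v v hε
    exact ⟨g, hg, h, by simp⟩
  · rintro s t hst ⟨h, hm, h1, h2⟩
    exact ⟨h, hm, h1, fun x hx => h2 x (hst hx)⟩
  · rintro s t ⟨h, hm, h1, h2⟩ ⟨k, km, k1, k2⟩
    refine ⟨h ⊓ k, hM.min_mem h hm k km, fun x => le_inf (h1 x) (k1 x), ?_⟩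
    rintro x (hx | hx)
    · exact inf_le_left.trans_lt (h2 x hx)
    · exact inf_le_right.trans_lt (k2 x hx)
  · intro x _
    obtain ⟨g, hg, -, h1, h2⟩ := hM.exists_lt_reducedFun_add v x hε
    refine ⟨{y | g y < reducedFun M v y + ε}, mem_nhdsWithin_of_mem_nhds ?_, g, hg, h1,
      fun y hy => hy⟩
    exact (isOpen_lt g.continuous ((hM.continuous_reducedFun v).add continuous_const)).mem_nhds h2

end IsLinearSeries

omit [Finite V] in
/-- The positions on an edge of the points of a finite set. -/
theorem finite_positions (Q : Finset Γ.Point) (e : Γ.graph.Dart) :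
    {t | t ∈ Icc 0 (Γ.len e) ∧ Γ.pt e t ∈ Q}.Finite :=
  Set.Finite.of_finite_image (Q.finite_toSet.subset (by rintro _ ⟨t, ht, rfl⟩; exact ht.2))
    fun _ hs _ ht h => Γ.pt_injOn e hs.1 ht.1 h

/-- The reduced function as a continuous map. -/
noncomputable def IsLinearSeries.reducedMap (hM : IsLinearSeries D S M) (v : Γ.Point) :
    C(Γ.Point, ℝ) := ⟨reducedFun M v, hM.continuous_reducedFun v⟩

namespace IsLinearSeries

variable (hM : IsLinearSeries D S M)

/-- On a segment with no point of the support of `D` in its interior, the elements of `M` are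
concave with supporting slopes in one finite set. Their infimum inherits this and is therefore
piecewise affine. The segments are then joined at the support of `D`. -/
theorem reducedMap_mem_rat (v : Γ.Point) : hM.reducedMap v ∈ Γ.Rat := by
  classical
  intro e
  let P := (finite_positions D.support e).toFinset
  have hu : Continuous fun t => reducedFun M v (Γ.pt e t) :=
    (hM.continuous_reducedFun v).comp (continuous_pt e)
  suffices H : ∃ P : Finset ℝ, ∀ a b, 0 ≤ a → a < b → b ≤ Γ.len e → (∀ p ∈ P, p ∉ Ioo a b) →
      ∃ m : ℤ, ∀ t ∈ Icc a b, reducedFun M v (Γ.pt e t) =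
        reducedFun M v (Γ.pt e a) + m * (t - a) from H
  refine interval_induction P (Q := fun c d => 0 ≤ c → d ≤ Γ.len e → ∃ P : Finset ℝ, ∀ a b, c ≤ a →
    a < b → b ≤ d → (∀ p ∈ P, p ∉ Ioo a b) → ∃ m : ℤ, ∀ t ∈ Icc a b,
      reducedFun M v (Γ.pt e t) = reducedFun M v (Γ.pt e a) + m * (t - a))
    ?_ ?_ (Γ.len_pos e) le_rfl le_rfl
  · intro c d hcd hP hc hd
    refine IntegralConcave.exists_breakpoints (F := S.slopeSet e)
      (IntegralConcave.of_approx fun s hs ε hε => ?_) hu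
    obtain ⟨g, hg, -, h1, h2⟩ := hM.exists_lt_reducedFun_add v (Γ.pt e s) hε
    refine ⟨_, integralConcave_of_mem (hM.subset hg) e hc hcd hd fun t ht => ?_,
      fun t _ => h1 _, h2⟩
    by_contra hD
    refine hP t ?_ ht
    simp only [P, Set.Finite.mem_toFinset, mem_ofPred_eq, Finsupp.mem_support_iff]
    exact ⟨⟨by linarith [ht.1], by linarith [ht.2]⟩, hD⟩
  · intro c p d hcp hpd _ h1 h2 hc hd
    obtain ⟨P₁, hP₁⟩ := h1 hc (by linarith)
    obtain ⟨P₂, hP₂⟩ := h2 (by linarith) hd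
    refine ⟨insert p (P₁ ∪ P₂), fun a b hca hab hbd hP => ?_⟩
    rcases le_or_gt b p with h | h
    · exact hP₁ a b hca hab h fun q hq => hP q (by simp [hq])
    · rcases le_or_gt p a with h' | h'
      · exact hP₂ a b h' hab hbd fun q hq => hP q (by simp [hq])
      · exact absurd ⟨h', h⟩ (hP p (by simp))

/-- A close enough approximant `g ∈ M` has all outgoing slopes at `x` at least those of `f_v`, hence
a smaller or equal order, and `D + div g` is effective. -/
theorem ord_reducedMap (v x : Γ.Point) : 0 ≤ D x + ord (hM.reducedMap v) x := by
  have hR := hM.reducedMap_mem_rat v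
  have h1 : ∀ᶠ h in 𝓝[>] (0 : ℝ), ∀ ν : Γ.Tangent x, ν.pos + h ≤ Γ.len ν.dart ∧
      hM.reducedMap v (Γ.pt ν.dart (ν.pos + h)) =
        hM.reducedMap v x + edgeSlope (hM.reducedMap v) ν.dart ν.pos * h ∧
      ∀ t ∈ Ioo ν.pos (ν.pos + h), D (Γ.pt ν.dart t) = 0 := by
    rw [eventually_all]
    intro ν
    have hs := Rat.hasEdgeSlope hR ν.pos_nonneg ν.pos_lt
    rw [HasEdgeSlope, ν.base] at hs
    have ht : Tendsto (fun h : ℝ => ν.pos + h) (𝓝[>] 0) (𝓝[>] ν.pos) := by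
      refine tendsto_nhdsWithin_iff.2 ⟨?_, ?_⟩
      · have : Tendsto (fun h : ℝ => ν.pos + h) (𝓝 0) (𝓝 (ν.pos + 0)) :=
          (continuous_const.add continuous_id).tendsto 0
        rw [add_zero] at this
        exact this.mono_left nhdsWithin_le_nhds
      · filter_upwards [self_mem_nhdsWithin] with h hh
        exact lt_add_of_pos_right _ (mem_Ioi.1 hh)
    filter_upwards [hs, ht.eventually (Ioo_mem_nhdsGT ν.pos_lt), ht.eventually
      (eventually_notMem_Ioo (finite_positions D.support ν.dart).toFinset ν.pos)] with h h1 h2 h3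
    refine ⟨h2.2.le, h1, fun t ht => ?_⟩
    by_contra hD
    refine h3 t ?_ ht
    simp only [Set.Finite.mem_toFinset, mem_ofPred_eq, Finsupp.mem_support_iff]
    exact ⟨⟨by linarith [ht.1, ν.pos_nonneg], by linarith [ht.2, h2.2]⟩, hD⟩
  -- One length `h` for all directions at `x`: up to `h`, `f_v` is affine and `D` vanishes strictly
  -- in between. An approximation error below `h` then changes a slope by less than `1`.
  obtain ⟨h, hh, h0⟩ := (h1.and self_mem_nhdsWithin).exists
  have h0 : 0 < h := h0
  obtain ⟨g, hg, hga⟩ := hM.exists_approx v (half_pos h0)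
  refine ((hM.subset hg).1.2 x).trans ?_
  rw [ord_eq, ord_eq]
  suffices H : ∀ ν : Γ.Tangent x, edgeSlope (hM.reducedMap v) ν.dart ν.pos ≤
      edgeSlope g ν.dart ν.pos by
    have := Finset.sum_le_sum fun ν (_ : ν ∈ Finset.univ) => H ν
    linarith
  intro ν
  obtain ⟨hl, ha, hD⟩ := hh ν
  have hK := integralConcave_of_mem (hM.subset hg) ν.dart ν.pos_nonneg
    (lt_add_of_pos_right ν.pos h0) hl hD
  obtain ⟨b, hb1, hb2, hb⟩ := Rat.exists_affine (hM.subset hg).1.1 ν.dart ν.pos_nonneg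
    (lt_add_of_pos_right ν.pos h0) hl
  have h3 := (hK.le_of_affine le_rfl hb1 hb2.le hb).2 (ν.pos + h) ⟨by linarith, le_rfl⟩
  simp only [ν.base] at h3
  have h4 := (hga (Γ.pt ν.dart (ν.pos + h))).1
  have h5 := (hga x).2
  change reducedFun M v _ = reducedFun M v x + _ at ha
  -- By concavity `g` lies below its initial line, so `f_v ≤ g` at distance `h` and `g(x) < f_v(x) +
  -- h / 2` bound the slope of `f_v`. Integrality of slopes removes the error.
  have h6 : (edgeSlope (hM.reducedMap v) ν.dart ν.pos : ℝ) * h <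
      (edgeSlope g ν.dart ν.pos + 1) * h := by
    linarith
  have h7 := lt_of_mul_lt_mul_right h6 h0.le
  exact Int.lt_add_one_iff.1 (by exact_mod_cast h7)

/-- Closedness of `M` is relative to `Rat(D)`, so membership of `f_v` in `Rat(D)` has to come first.
-/
theorem reducedMap_mem (v : Γ.Point) : hM.reducedMap v ∈ M := by
  have hR : hM.reducedMap v ∈ RatD D := ⟨hM.reducedMap_mem_rat v, hM.ord_reducedMap v⟩
  suffices H : (⟨hM.reducedMap v, hR⟩ : RatD D) ∈ closure ((↑) ⁻¹' M : Set (RatD D)) by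
    rw [hM.isClosed.closure_eq] at H
    exact H
  rw [Metric.mem_closure_iff]
  intro ε hε
  obtain ⟨g, hg, hga⟩ := hM.exists_approx v hε
  refine ⟨⟨g, (hM.subset hg).1⟩, hg, ?_⟩
  rw [Subtype.dist_eq, ContinuousMap.dist_lt_iff hε]
  intro x
  have := hga x
  rw [Real.dist_eq, abs_sub_comm, abs_lt]
  change -ε < g x - reducedFun M v x ∧ g x - reducedFun M v x < ε
  constructor <;> linarith

end IsLinearSeries

end MetricGraph

namespace MetricGraph

variable {V : Type*} {Γ : MetricGraph V}

/-! ### Green's identity -/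

/-- A finite set of points containing the vertices such that `f` is affine on the segments without
an interior point in it. -/
structure IsBreakSet (f : Γ.Point → ℝ) (Q : Finset Γ.Point) : Prop where
  vtx_mem : ∀ v, Γ.vtx v ∈ Q
  affine : ∀ (e : Γ.graph.Dart) (a b : ℝ), 0 ≤ a → a < b → b ≤ Γ.len e →
    (∀ t ∈ Ioo a b, Γ.pt e t ∉ Q) →
      ∃ m : ℤ, ∀ t ∈ Icc a b, f (Γ.pt e t) = f (Γ.pt e a) + m * (t - a)

theorem IsBreakSet.mono {f : Γ.Point → ℝ} {Q Q' : Finset Γ.Point} (h : IsBreakSet f Q)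
    (hQ : Q ⊆ Q') : IsBreakSet f Q' :=
  ⟨fun v => hQ (h.vtx_mem v), fun e a b h0 hab h1 hn =>
    h.affine e a b h0 hab h1 fun t ht hm => hn t ht (hQ hm)⟩

theorem hasEdgeSlope_const (c : ℝ) (e : Γ.graph.Dart) (t : ℝ) :
    HasEdgeSlope (fun _ : Γ.Point => c) e t 0 := Eventually.of_forall fun h => by simp

theorem const_mem_rat (c : ℝ) : ContinuousMap.const Γ.Point c ∈ Γ.Rat :=
  fun _ => ⟨∅, fun _ _ _ _ _ _ => ⟨0, by simp⟩⟩

theorem Rat.exists_isBreakSet [Finite V] {f : C(Γ.Point, ℝ)} (hf : f ∈ Γ.Rat) :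
    ∃ Q, IsBreakSet f Q := by
  classical
  have := Fintype.ofFinite V
  have := Fintype.ofFinite Γ.graph.Dart
  choose P hP using hf
  refine ⟨Finset.univ.image Γ.vtx ∪ Finset.univ.biUnion fun e => (P e).image (Γ.pt e),
    fun v => by simp, fun e a b h0 hab h1 hn => hP e a b h0 hab h1 fun p hp hab => hn p hab ?_⟩
  simp only [Finset.mem_union, Finset.mem_biUnion, Finset.mem_univ, true_and]
  exact Or.inr ⟨e, Finset.mem_image_of_mem _ hp⟩

theorem IsBreakSet.ord_eq_zero [Finite V] {f : Γ.Point → ℝ} {Q : Finset Γ.Point}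
    (h : IsBreakSet f Q) {x : Γ.Point} (hx : x ∉ Q) : ord f x = 0 := by
  rcases point_cases x with ⟨v, rfl⟩ | ⟨e, t, h0, h1, rfl⟩
  · exact absurd (h.vtx_mem v) hx
  have h2 : ∀ᶠ s in 𝓝 t, Γ.pt e s ∉ Q :=
    (continuous_pt e).continuousAt.eventually (Q.finite_toSet.isClosed.isOpen_compl.mem_nhds hx)
  obtain ⟨ε, hε, hb⟩ := Metric.eventually_nhds_iff.1
    (h2.and ((eventually_gt_nhds h0).and (eventually_lt_nhds h1)))
  have h3 : ∀ s ∈ Icc (t - ε / 2) (t + ε / 2), Γ.pt e s ∉ Q ∧ 0 < s ∧ s < Γ.len e := fun s hs =>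
    hb (by rw [Real.dist_eq, abs_lt]; constructor <;> linarith [hs.1, hs.2])
  have h4 := (h3 (t - ε / 2) ⟨le_rfl, by linarith⟩).2.1
  have h5 := (h3 (t + ε / 2) ⟨by linarith, le_rfl⟩).2.2
  obtain ⟨m, hm⟩ := h.affine e (t - ε / 2) (t + ε / 2) h4.le (by linarith) h5.le
    fun s hs => (h3 s ⟨hs.1.le, hs.2.le⟩).1
  have h6 := hasEdgeSlope_of_affine (show t < t + ε / 2 by linarith)
    (affine_mono (u := fun s => f (Γ.pt e s)) hm (show t - ε / 2 ≤ t by linarith) le_rfl)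
  have h7 := hasEdgeSlope_symm_of_affine h4.le (show t - ε / 2 < t by linarith) h1.le
    fun s hs => hm s ⟨hs.1, by linarith [hs.2]⟩
  rw [ord_interior _ h0 h1, h6.edgeSlope_eq, h7.edgeSlope_eq]
  ring

/-- The contribution of the segment `[a, b]` of `e` to the pairing of `φ` with the divisor of `f`. -/
noncomputable def edgePairing (A : Finset ℝ) (e : Γ.graph.Dart) (φ f : Γ.Point → ℝ) (a b : ℝ) : ℝ :=
  φ (Γ.pt e a) * edgeSlope f e a + φ (Γ.pt e b) * edgeSlope f e.symm (Γ.len e - b) +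
    ∑ t ∈ A with t ∈ Ioo a b,
      φ (Γ.pt e t) * (edgeSlope f e t + edgeSlope f e.symm (Γ.len e - t))

/-- The two end terms at the cut point `p` add up to the interior term of `p`. -/
theorem edgePairing_add {A : Finset ℝ} (e : Γ.graph.Dart) (φ f : Γ.Point → ℝ) {a p b : ℝ}
    (hap : a < p) (hpb : p < b) (hp : p ∈ A) :
    edgePairing A e φ f a b = edgePairing A e φ f a p + edgePairing A e φ f p b := by
  classical
  have h : A.filter (· ∈ Ioo a b) =
      insert p (A.filter (· ∈ Ioo a p) ∪ A.filter (· ∈ Ioo p b)) := by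
    ext t
    simp only [Finset.mem_filter, Finset.mem_insert, Finset.mem_union, mem_Ioo]
    constructor
    · rintro ⟨h1, h2, h3⟩
      rcases lt_trichotomy t p with h | h | h
      · exact Or.inr (Or.inl ⟨h1, h2, h⟩)
      · exact Or.inl h
      · exact Or.inr (Or.inr ⟨h1, h, h3⟩)
    · rintro (rfl | ⟨h1, h2, h3⟩ | ⟨h1, h2, h3⟩)
      · exact ⟨hp, hap, hpb⟩
      · exact ⟨h1, h2, h3.trans hpb⟩
      · exact ⟨h1, hap.trans h2, h3⟩
  have hd : Disjoint (A.filter (· ∈ Ioo a p)) (A.filter (· ∈ Ioo p b)) := by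
    rw [Finset.disjoint_filter]
    intro t _ h1 h2
    exact lt_asymm h1.2 h2.1
  unfold edgePairing
  rw [h, Finset.sum_insert (by simp), Finset.sum_union hd]
  ring

/-- On a segment where `φ` and `f` are affine of slopes `c` and `m`, the pairing is `(φ(a) - φ(b)) m
= -c m (b - a)`, which is symmetric. Additivity does the rest. -/
theorem edgePairing_comm {Q : Finset Γ.Point} {φ f : Γ.Point → ℝ} (hφ : IsBreakSet φ Q)
    (hf : IsBreakSet f Q) {A : Finset ℝ} {e : Γ.graph.Dart}
    (hA : ∀ t ∈ Ioo 0 (Γ.len e), Γ.pt e t ∈ Q → t ∈ A) :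
    edgePairing A e φ f 0 (Γ.len e) = edgePairing A e f φ 0 (Γ.len e) := by
  refine interval_induction A (Q := fun a b => 0 ≤ a → b ≤ Γ.len e →
    edgePairing A e φ f a b = edgePairing A e f φ a b) ?_ ?_ (Γ.len_pos e) le_rfl le_rfl
  · intro a b hab hn h0 h1
    have hn' : ∀ t ∈ Ioo a b, Γ.pt e t ∉ Q := fun t ht hQ =>
      hn t (hA t ⟨by linarith [ht.1], by linarith [ht.2]⟩ hQ) ht
    obtain ⟨m, hm⟩ := hf.affine e a b h0 hab h1 hn'
    obtain ⟨c, hc⟩ := hφ.affine e a b h0 hab h1 hn'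
    have hF : A.filter (· ∈ Ioo a b) = ∅ := Finset.filter_eq_empty_iff.2 fun t ht => hn t ht
    unfold edgePairing
    rw [hF, (hasEdgeSlope_of_affine hab hm).edgeSlope_eq,
      (hasEdgeSlope_of_affine hab hc).edgeSlope_eq,
      (hasEdgeSlope_symm_of_affine h0 hab h1 hm).edgeSlope_eq,
      (hasEdgeSlope_symm_of_affine h0 hab h1 hc).edgeSlope_eq, hm b ⟨hab.le, le_rfl⟩,
      hc b ⟨hab.le, le_rfl⟩]
    push_cast
    simp only [Finset.sum_empty]
    ring
  · intro a p b hap hpb hp h1 h2 h0 hl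
    rw [edgePairing_add e φ f hap hpb hp, edgePairing_add e f φ hap hpb hp, h1 h0 (by linarith),
      h2 (by linarith) hl]

/-- The positions in the interior of `e` of the points of `Q`. -/
noncomputable def interiorPositions (Q : Finset Γ.Point) (e : Γ.graph.Dart) : Finset ℝ :=
  ((finite_positions Q e).subset (t := {t | t ∈ Ioo 0 (Γ.len e) ∧ Γ.pt e t ∈ Q})
    fun _ ht => ⟨⟨ht.1.1.le, ht.1.2.le⟩, ht.2⟩).toFinset

theorem mem_interiorPositions {Q : Finset Γ.Point} {e : Γ.graph.Dart} {t : ℝ} :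
    t ∈ interiorPositions Q e ↔ t ∈ Ioo 0 (Γ.len e) ∧ Γ.pt e t ∈ Q := by
  simp [interiorPositions]

variable [Finite V]

/-- A point with a tangent there amounts to a dart with a position in `[0, len e)`. Since `Q`
contains the vertices, position `0` occurs on every dart. -/
theorem sum_mul_ord [Fintype Γ.graph.Dart] {Q : Finset Γ.Point} (hQ : ∀ v, Γ.vtx v ∈ Q)
    (φ f : Γ.Point → ℝ) : ∑ x ∈ Q, φ x * ord f x =
      -∑ e : Γ.graph.Dart, (φ (Γ.pt e 0) * edgeSlope f e 0 +
        ∑ t ∈ interiorPositions Q e, φ (Γ.pt e t) * edgeSlope f e t) := by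
  classical
  have h1 : ∀ e : Γ.graph.Dart, φ (Γ.pt e 0) * edgeSlope f e 0 +
      ∑ t ∈ interiorPositions Q e, φ (Γ.pt e t) * edgeSlope f e t =
      ∑ t ∈ insert 0 (interiorPositions Q e), φ (Γ.pt e t) * edgeSlope f e t := fun e => by
    rw [Finset.sum_insert (by simp [mem_interiorPositions])]
  simp only [h1, ord_eq, Int.cast_neg, Int.cast_sum, mul_neg, Finset.sum_neg_distrib,
    Finset.mul_sum]
  rw [neg_inj, Finset.sum_sigma', Finset.sum_sigma']
  refine Finset.sum_bij (fun p _ => ⟨p.2.dart, p.2.pos⟩) ?_ ?_ ?_ ?_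
  · rintro ⟨x, ν⟩ hx
    simp only [Finset.mem_sigma, Finset.mem_univ, and_true, true_and, Finset.mem_insert,
      mem_interiorPositions] at hx ⊢
    rcases ν.pos_nonneg.eq_or_lt with h | h
    · exact Or.inl h.symm
    · exact Or.inr ⟨⟨h, ν.pos_lt⟩, by rwa [ν.base]⟩
  · rintro ⟨x, ⟨e, t, h0, h1, rfl⟩⟩ _ ⟨y, ⟨e', t', h0', h1', rfl⟩⟩ _ h
    obtain ⟨rfl, h⟩ := Sigma.mk.inj h
    obtain rfl := eq_of_heq h
    rfl
  · rintro ⟨e, t⟩ ht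
    simp only [Finset.mem_sigma, Finset.mem_univ, true_and, Finset.mem_insert,
      mem_interiorPositions] at ht
    have h2 : 0 ≤ t ∧ t < Γ.len e ∧ Γ.pt e t ∈ Q := by
      rcases ht with rfl | ht
      · exact ⟨le_rfl, Γ.len_pos e, by rw [pt_zero]; exact hQ _⟩
      · exact ⟨ht.1.1.le, ht.1.2, ht.2⟩
    exact ⟨⟨Γ.pt e t, ⟨e, t, h2.1, h2.2.1, rfl⟩⟩, by simp [h2.2.2], rfl⟩
  · rintro ⟨x, ν⟩ _
    simp only [ν.base]

/-- The pairing on `e` collects the slopes of both orientations, so summing over darts counts every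
tangent twice. -/
theorem two_mul_sum_mul_ord [Fintype Γ.graph.Dart] {Q : Finset Γ.Point} (hQ : ∀ v, Γ.vtx v ∈ Q)
    (φ f : Γ.Point → ℝ) : 2 * ∑ x ∈ Q, φ x * ord f x =
      -∑ e : Γ.graph.Dart, edgePairing (interiorPositions Q e) e φ f 0 (Γ.len e) := by
  classical
  let σ : Equiv.Perm Γ.graph.Dart := 
    (SimpleGraph.Dart.symm_involutive (G := Γ.graph)).toPerm
  let X : Γ.graph.Dart → ℝ := fun e => φ (Γ.pt e 0) * edgeSlope f e 0 +
    ∑ t ∈ interiorPositions Q e, φ (Γ.pt e t) * edgeSlope f e t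
  have h1 : ∑ e : Γ.graph.Dart, X e.symm = ∑ e, X e := Equiv.sum_comp σ X
  have h2 : ∀ e : Γ.graph.Dart, edgePairing (interiorPositions Q e) e φ f 0 (Γ.len e) =
      X e + X e.symm := by
    intro e
    have h3 : ∑ t ∈ interiorPositions Q e.symm, φ (Γ.pt e.symm t) * edgeSlope f e.symm t =
        ∑ t ∈ interiorPositions Q e, φ (Γ.pt e t) * edgeSlope f e.symm (Γ.len e - t) := by
      have hpt : ∀ t ∈ Ioo 0 (Γ.len e), Γ.pt e.symm (Γ.len e - t) = Γ.pt e t := fun t ht =>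
        pt_symm e ⟨ht.1.le, ht.2.le⟩
      refine (Finset.sum_nbij' (fun t => Γ.len e - t) (fun t => Γ.len e - t) ?_ ?_ ?_ ?_ ?_).symm
      · intro t ht
        rw [mem_interiorPositions] at ht ⊢
        rw [Γ.len_symm, hpt t ht.1]
        exact ⟨⟨by linarith [ht.1.2], by linarith [ht.1.1]⟩, ht.2⟩
      · intro t ht
        rw [mem_interiorPositions, Γ.len_symm] at ht
        have ht' : Γ.len e - t ∈ Ioo 0 (Γ.len e) := ⟨by linarith [ht.1.2], by linarith [ht.1.1]⟩
        rw [mem_interiorPositions, ← hpt _ ht', sub_sub_cancel]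
        exact ⟨ht', ht.2⟩
      · simp
      · simp
      · intro t ht
        rw [hpt t (mem_interiorPositions.1 ht).1]
    have h4 : (interiorPositions Q e).filter (· ∈ Ioo 0 (Γ.len e)) = interiorPositions Q e :=
      Finset.filter_true_of_mem fun t ht => (mem_interiorPositions.1 ht).1
    have h5 : Γ.pt e (Γ.len e) = Γ.pt e.symm 0 := by
      rw [pt_len, pt_zero]
      rfl
    simp only [edgePairing, X, h3, h4, h5, sub_self, mul_add, Finset.sum_add_distrib]
    ring
  have h3 : ∑ x ∈ Q, φ x * ord f x = -∑ e, X e := sum_mul_ord hQ φ f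
  rw [h3, Finset.sum_congr rfl fun e _ => h2 e, Finset.sum_add_distrib (f := X), h1]
  ring

theorem finsum_mul_ord_eq_sum {φ f : Γ.Point → ℝ} {Q : Finset Γ.Point} (h : IsBreakSet f Q) :
    ∑ᶠ x, φ x * ord f x = ∑ x ∈ Q, φ x * ord f x := by
  refine finsum_eq_sum_of_support_subset _ fun x hx => ?_
  by_contra hQ
  exact hx (by simp [h.ord_eq_zero hQ])

/-- Green's identity. -/
theorem finsum_mul_ord_comm {φ f : C(Γ.Point, ℝ)} (hφ : φ ∈ Γ.Rat) (hf : f ∈ Γ.Rat) :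
    ∑ᶠ x, φ x * ord f x = ∑ᶠ x, f x * ord φ x := by
  classical
  have := Fintype.ofFinite Γ.graph.Dart
  obtain ⟨Q₁, hQ₁⟩ := Rat.exists_isBreakSet hφ
  obtain ⟨Q₂, hQ₂⟩ := Rat.exists_isBreakSet hf
  have h1 := hQ₁.mono (Finset.subset_union_left (s₂ := Q₂))
  have h2 := hQ₂.mono (Finset.subset_union_right (s₁ := Q₁))
  rw [finsum_mul_ord_eq_sum h1, finsum_mul_ord_eq_sum h2]
  have h3 := two_mul_sum_mul_ord h1.vtx_mem φ f
  have h4 := two_mul_sum_mul_ord h1.vtx_mem f φ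
  have h5 := fun e => edgePairing_comm h1 h2 (e := e)
    (A := interiorPositions (Q₁ ∪ Q₂) e) fun t ht hQ => mem_interiorPositions.2 ⟨ht, hQ⟩
  simp only [h5] at h3
  linarith

theorem ord_const (c : ℝ) (x : Γ.Point) : ord (fun _ : Γ.Point => c) x = 0 := by
  simp [ord_eq, (hasEdgeSlope_const c _ _).edgeSlope_eq]

/-- Principal divisors have degree zero. -/
theorem finsum_ord {f : C(Γ.Point, ℝ)} (hf : f ∈ Γ.Rat) : ∑ᶠ x, (ord f x : ℝ) = 0 := by
  have h := finsum_mul_ord_comm (const_mem_rat 1) hf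
  have h1 : ∀ x, ord (ContinuousMap.const Γ.Point (1 : ℝ)) x = 0 := ord_const 1
  simp only [h1] at h
  simpa using h

end MetricGraph

/-! ### Tents -/

/-- The tent of height `h` and slopes `1`, `-1` centred at `c`. -/
noncomputable def tent (c h t : ℝ) : ℝ := max 0 (h - |t - c|)

theorem tent_eq_zero {c h t : ℝ} (ht : h ≤ |t - c|) : tent c h t = 0 := max_eq_left (by linarith)

theorem tent_self {c h : ℝ} (hh : 0 ≤ h) : tent c h c = h := by simp [tent, hh]

theorem tent_nonneg (c h t : ℝ) : 0 ≤ tent c h t := le_max_left _ _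

theorem tent_le {c h t : ℝ} (hh : 0 ≤ h) : tent c h t ≤ h :=
  max_le hh (by linarith [abs_nonneg (t - c)])

theorem tent_reflect (c h t l : ℝ) : tent (l - c) h (l - t) = tent c h t := by
  rw [tent, tent, show l - t - (l - c) = -(t - c) by ring, abs_neg]

theorem continuous_tent (c h : ℝ) : Continuous (tent c h) := by
  unfold tent
  fun_prop

theorem tent_affine {c h a b : ℝ} (hab : a < b)
    (hP : ∀ p ∈ ({c - h, c, c + h} : Finset ℝ), p ∉ Ioo a b) :
    ∃ m : ℤ, ∀ t ∈ Icc a b, tent c h t = tent c h a + m * (t - a) := by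
  have key : ∀ p, p ∉ Ioo a b → b ≤ p ∨ p ≤ a := fun p hp => by
    by_contra! hc
    exact hp ⟨hc.2, hc.1⟩
  have h1 := key _ (hP (c - h) (by simp))
  have h2 := key _ (hP c (by simp))
  have h3 := key _ (hP (c + h) (by simp))
  have hz : (∀ t ∈ Icc a b, h ≤ |t - c|) →
      ∃ m : ℤ, ∀ t ∈ Icc a b, tent c h t = tent c h a + m * (t - a) := fun H =>
    ⟨0, fun t ht => by simp [tent_eq_zero (H t ht), tent_eq_zero (H a ⟨le_rfl, hab.le⟩)]⟩
  rcases h2 with h2 | h2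
  · rcases h1 with h1 | h1
    · exact hz fun t ht => by rw [abs_sub_comm]; exact le_trans (by linarith [ht.2]) (le_abs_self _)
    · have hv : ∀ t ∈ Icc a b, tent c h t = h - (c - t) := fun t ht => by
        rw [tent, abs_sub_comm, abs_of_nonneg (by linarith [ht.2]), max_eq_right]
        linarith [ht.1]
      exact ⟨1, fun t ht => by rw [hv t ht, hv a ⟨le_rfl, hab.le⟩]; push_cast; ring⟩
  · rcases h3 with h3 | h3
    · have hv : ∀ t ∈ Icc a b, tent c h t = h - (t - c) := fun t ht => by
        rw [tent, abs_of_nonneg (by linarith [ht.1]), max_eq_right]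
        linarith [ht.2]
      exact ⟨-1, fun t ht => by rw [hv t ht, hv a ⟨le_rfl, hab.le⟩]; push_cast; ring⟩
    · exact hz fun t ht => le_trans (by linarith [ht.1]) (le_abs_self _)

/-! ### Tents on the metric graph. -/

namespace MetricGraph

variable {V : Type*} {Γ : MetricGraph V}

/-- Rational functions can be defined edge by edge. -/
theorem exists_rat (val : V → ℝ) (u : Γ.graph.Dart → ℝ → ℝ) (h0 : ∀ e, u e 0 = val e.fst)
    (hs : ∀ e, ∀ t ∈ Icc 0 (Γ.len e), u e.symm (Γ.len e - t) = u e t)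
    (hc : ∀ e, Continuous (u e))
    (hP : ∀ e, ∃ P : Finset ℝ, ∀ a b : ℝ, a < b → (∀ p ∈ P, p ∉ Ioo a b) →
      ∃ m : ℤ, ∀ t ∈ Icc a b, u e t = u e a + m * (t - a)) :
    ∃ φ ∈ Γ.Rat, (∀ v, φ (Γ.vtx v) = val v) ∧ ∀ e, ∀ t ∈ Icc 0 (Γ.len e), φ (Γ.pt e t) = u e t := by
  let F : Γ.Point → ℝ := Quot.lift (Sum.elim val fun p => u p.1 p.2) (by
    intro p q hpq
    cases hpq with
    | tail e t ht => simp [ht, h0]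
    | flip e s t h =>
      have : (t : ℝ) = Γ.len e - s := by linarith
      simp [this, hs e s s.2])
  have hF : ∀ e, ∀ t ∈ Icc 0 (Γ.len e), F (Γ.pt e t) = u e t := fun e t ht => by
    have : F (Γ.pt e t) = u e (projIcc 0 (Γ.len e) (Γ.len_pos e).le t) := rfl
    rw [this, projIcc_of_mem _ ht]
  have hFc : Continuous F := continuous_point fun e => (hc e).continuousOn.congr (hF e)
  refine ⟨⟨F, hFc⟩, fun e => ?_, fun v => rfl, hF⟩
  obtain ⟨P, hP⟩ := hP e
  refine ⟨P, fun a b ha hab hb hp => ?_⟩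
  obtain ⟨m, hm⟩ := hP a b hab hp
  refine ⟨m, fun t ht => ?_⟩
  change F (Γ.pt e t) = F (Γ.pt e a) + _
  rw [hF e t ⟨ha.trans ht.1, ht.2.trans hb⟩, hF e a ⟨ha, hab.le.trans hb⟩, hm t ht]

/-- The radius `h` keeps the positions within `h` of `t₀` strictly inside `e₀` and their points in
`U`. So the tent vanishes at both ends of the edge and extends by zero. -/
theorem exists_tent_interior {U : Set Γ.Point} (hU : IsOpen U) {e₀ : Γ.graph.Dart} {t₀ : ℝ}
    (ht0 : 0 < t₀) (ht1 : t₀ < Γ.len e₀) (hx : Γ.pt e₀ t₀ ∈ U) :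
    ∃ φ ∈ Γ.Rat, (∀ y, 0 ≤ φ y ∧ φ y ≤ φ (Γ.pt e₀ t₀)) ∧ 0 < φ (Γ.pt e₀ t₀) ∧
      ∀ y ∉ U, φ y = 0 := by
  classical
  have h1 : ∀ᶠ s in 𝓝 t₀, Γ.pt e₀ s ∈ U ∧ 0 < s ∧ s < Γ.len e₀ :=
    ((continuous_pt e₀).continuousAt.eventually (hU.mem_nhds hx)).and
      ((eventually_gt_nhds ht0).and (eventually_lt_nhds ht1))
  obtain ⟨h, hh, hb⟩ := Metric.eventually_nhds_iff.1 h1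
  have hz0 : h ≤ |0 - t₀| := by
    by_contra! hc
    exact lt_irrefl _ (hb (y := 0) hc).2.1
  have hzl : h ≤ |Γ.len e₀ - t₀| := by
    by_contra! hc
    exact lt_irrefl _ (hb (y := Γ.len e₀) hc).2.2
  have hne : ∀ e : Γ.graph.Dart, e.symm ≠ e := SimpleGraph.Dart.symm_ne
  have hsy : ∀ {e e' : Γ.graph.Dart}, e.symm = e' ↔ e = e'.symm := fun {e e'} =>
    ⟨fun h => by rw [← h, SimpleGraph.Dart.symm_symm], fun h => by
      rw [h, SimpleGraph.Dart.symm_symm]⟩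
  obtain ⟨φ, hφ, hv, he⟩ := exists_rat (Γ := Γ) (fun _ => 0)
    (fun e => if e = e₀ then tent t₀ h else if e = e₀.symm then tent (Γ.len e₀ - t₀) h else 0)
    (fun e => by
      split_ifs
      · exact tent_eq_zero hz0
      · refine tent_eq_zero ?_
        rwa [zero_sub, abs_neg]
      · rfl)
    (fun e t _ => by
      by_cases h1 : e = e₀
      · subst h1
        simp [hne, tent_reflect]
      · by_cases h2 : e = e₀.symm
        · subst h2
          simp only [SimpleGraph.Dart.symm_symm, if_true, if_neg (hne e₀), Γ.len_symm]
          rw [← tent_reflect _ h t (Γ.len e₀), sub_sub_cancel]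
        · have h3 : e.symm ≠ e₀ := fun h => h2 (hsy.1 h)
          have h4 : e.symm ≠ e₀.symm := fun h => h1 (by simpa using hsy.1 h)
          simp [h1, h2, h3, h4])
    (fun e => by
      split_ifs
      · exact continuous_tent _ _
      · exact continuous_tent _ _
      · exact continuous_const)
    (fun e => by
      split_ifs
      · exact ⟨_, fun a b hab hP => tent_affine hab hP⟩
      · exact ⟨_, fun a b hab hP => tent_affine hab hP⟩
      · exact ⟨∅, fun a b _ _ => ⟨0, by simp⟩⟩)
  have hx0 : φ (Γ.pt e₀ t₀) = h := by
    rw [he e₀ t₀ ⟨ht0.le, ht1.le⟩, if_pos rfl, tent_self hh.le]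
  have hin : ∀ s, tent t₀ h s ≠ 0 → Γ.pt e₀ s ∈ U := fun s hs =>
    (hb (lt_of_not_ge fun hc => hs (tent_eq_zero hc))).1
  refine ⟨φ, hφ, fun y => ?_, hx0 ▸ hh, fun y hy => ?_⟩
  · rcases point_cases y with ⟨v, rfl⟩ | ⟨e, t, h0, h1, rfl⟩
    · rw [hv]
      exact ⟨le_rfl, hx0 ▸ hh.le⟩
    · rw [he e t ⟨h0.le, h1.le⟩, hx0]
      split_ifs
      · exact ⟨tent_nonneg _ _ _, tent_le hh.le⟩
      · exact ⟨tent_nonneg _ _ _, tent_le hh.le⟩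
      · exact ⟨le_rfl, hh.le⟩
  · by_contra hc
    apply hy
    rcases point_cases y with ⟨v, rfl⟩ | ⟨e, t, h0, h1, rfl⟩
    · exact absurd (hv v) hc
    · rw [he e t ⟨h0.le, h1.le⟩] at hc
      split_ifs at hc with h2 h3
      · subst h2
        exact hin t hc
      · subst h3
        rw [Γ.len_symm] at h1
        rw [← pt_symm e₀.symm ⟨h0.le, by rw [Γ.len_symm]; exact h1.le⟩,
          SimpleGraph.Dart.symm_symm, Γ.len_symm]
        refine hin _ ?_
        rwa [← tent_reflect _ _ _ (Γ.len e₀), sub_sub_cancel]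
      · exact absurd rfl hc

/-- The radius is shorter than every edge, so the tent vanishes at the other vertices. The graph has
no loops, so `v` is never both ends of an edge and the two nonzero branches do not conflict. -/
theorem exists_tent_vtx [Finite V] {U : Set Γ.Point} (hU : IsOpen U) {v : V} (hx : Γ.vtx v ∈ U) :
    ∃ φ ∈ Γ.Rat, (∀ y, 0 ≤ φ y ∧ φ y ≤ φ (Γ.vtx v)) ∧ 0 < φ (Γ.vtx v) ∧ ∀ y ∉ U, φ y = 0 := by
  classical
  have h1 : ∀ᶠ h in 𝓝[>] (0 : ℝ), ∀ e : Γ.graph.Dart, h < Γ.len e ∧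
      (e.fst = v → ∀ s, |s| < h → Γ.pt e s ∈ U) := by
    rw [eventually_all]
    intro e
    have h2 : ∀ᶠ h in 𝓝[>] (0 : ℝ), h < Γ.len e :=
      (eventually_lt_nhds (Γ.len_pos e)).filter_mono nhdsWithin_le_nhds
    by_cases hev : e.fst = v
    · have h3 : ∀ᶠ s in 𝓝 (0 : ℝ), Γ.pt e s ∈ U :=
        (continuous_pt e).continuousAt.eventually (hU.mem_nhds (by rwa [pt_zero, hev]))
      obtain ⟨ε, hε, hb⟩ := Metric.eventually_nhds_iff.1 h3
      filter_upwards [h2, Ioo_mem_nhdsGT hε] with h h4 h5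
      exact ⟨h4, fun _ s hs => hb (by rw [Real.dist_eq, sub_zero]; exact hs.trans h5.2)⟩
    · filter_upwards [h2] with h h4
      exact ⟨h4, fun h => absurd h hev⟩
  obtain ⟨h, hb, hh⟩ := (h1.and self_mem_nhdsWithin).exists
  have hh : 0 < h := hh
  have hne : ∀ e : Γ.graph.Dart, e.snd ≠ e.fst := fun e => e.adj.ne'
  have hz : ∀ e : Γ.graph.Dart, h ≤ |0 - Γ.len e| := fun e => by
    rw [zero_sub, abs_neg, abs_of_pos (Γ.len_pos e)]
    exact (hb e).1.le
  obtain ⟨φ, hφ, hv, he⟩ := exists_rat (Γ := Γ) (fun w => if w = v then h else 0)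
    (fun e => if e.fst = v then tent 0 h else if e.snd = v then tent (Γ.len e) h else 0)
    (fun e => by
      split_ifs
      · exact tent_self hh.le
      · exact tent_eq_zero (hz e)
      · rfl)
    (fun e t _ => by
      have e1 : e.symm.fst = e.snd := rfl
      have e2 : e.symm.snd = e.fst := rfl
      rw [e1, e2, Γ.len_symm]
      by_cases h1 : e.fst = v
      · have h2 : e.snd ≠ v := fun h => hne e (h.trans h1.symm)
        rw [if_neg h2, if_pos h1, if_pos h1, ← tent_reflect 0 h t (Γ.len e), sub_zero]
      · by_cases h2 : e.snd = v
        · rw [if_pos h2, if_neg h1, if_pos h2, ← tent_reflect _ h t (Γ.len e), sub_self]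
        · rw [if_neg h2, if_neg h1, if_neg h1, if_neg h2]
          rfl)
    (fun e => by
      split_ifs
      · exact continuous_tent _ _
      · exact continuous_tent _ _
      · exact continuous_const)
    (fun e => by
      split_ifs
      · exact ⟨_, fun a b hab hP => tent_affine hab hP⟩
      · exact ⟨_, fun a b hab hP => tent_affine hab hP⟩
      · exact ⟨∅, fun a b _ _ => ⟨0, by simp⟩⟩)
  have hx0 : φ (Γ.vtx v) = h := by rw [hv, if_pos rfl]
  have hin : ∀ e : Γ.graph.Dart, e.fst = v → ∀ s, tent 0 h s ≠ 0 → Γ.pt e s ∈ U :=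
    fun e hev s hs => (hb e).2 hev s (lt_of_not_ge fun hc => hs (tent_eq_zero (by simpa using hc)))
  refine ⟨φ, hφ, fun y => ?_, by rwa [hx0], fun y hy => ?_⟩
  · rw [hx0]
    rcases point_cases y with ⟨w, rfl⟩ | ⟨e, t, h0, h1, rfl⟩
    · rw [hv]
      split_ifs
      · exact ⟨hh.le, le_rfl⟩
      · exact ⟨le_rfl, hh.le⟩
    · rw [he e t ⟨h0.le, h1.le⟩]
      split_ifs
      · exact ⟨tent_nonneg _ _ _, tent_le hh.le⟩
      · exact ⟨tent_nonneg _ _ _, tent_le hh.le⟩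
      · exact ⟨le_rfl, hh.le⟩
  · by_contra hc
    apply hy
    rcases point_cases y with ⟨w, rfl⟩ | ⟨e, t, h0, h1, rfl⟩
    · rw [hv] at hc
      split_ifs at hc with h2
      · rwa [h2]
      · exact absurd rfl hc
    · rw [he e t ⟨h0.le, h1.le⟩] at hc
      split_ifs at hc with h2 h3
      · exact hin e h2 t hc
      · rw [← pt_symm e ⟨h0.le, h1.le⟩]
        refine hin e.symm h3 _ ?_
        rwa [← tent_reflect _ _ _ (Γ.len e), sub_self] at hc
      · exact absurd rfl hc

/-- Tents supported in arbitrarily small neighbourhoods. -/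
theorem exists_tent [Finite V] {U : Set Γ.Point} (hU : IsOpen U) {x : Γ.Point} (hx : x ∈ U) :
    ∃ φ ∈ Γ.Rat, (∀ y, 0 ≤ φ y ∧ φ y ≤ φ x) ∧ 0 < φ x ∧ ∀ y ∉ U, φ y = 0 := by
  rcases point_cases x with ⟨v, rfl⟩ | ⟨e, t, h0, h1, rfl⟩
  · exact exists_tent_vtx hU hx
  · exact exists_tent_interior hU h0 h1 hx

instance [Finite V] : T2Space Γ.Point := by
  refine ⟨fun x y hxy => ?_⟩
  obtain ⟨φ, -, -, h1, h2⟩ := exists_tent (isOpen_compl_singleton (x := y)) hxy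
  refine separated_by_continuous φ.continuous ?_
  rw [h2 y (by simp)]
  exact h1.ne'

end MetricGraph

namespace MetricGraph

variable {V : Type*} {Γ : MetricGraph V} {d : ℕ}

/-! ### The symmetric product -/

/-- The point of the symmetric product given by a tuple. -/
def symOf (p : Fin d → Γ.Point) : Sym Γ.Point d := ⟨Multiset.map p Finset.univ.val, by simp⟩

theorem exists_symOf (E : Sym Γ.Point d) : ∃ p : Fin d → Γ.Point, symOf p = E := by
  obtain ⟨s, hs⟩ := E
  induction s using Quot.ind with
  | mk l =>
    obtain rfl : l.length = d := hs
    refine ⟨l.get, Subtype.ext ?_⟩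
    change Multiset.map l.get Finset.univ.val = _
    rw [Fin.univ_val_map, List.ofFn_get]
    rfl

theorem isOpen_sym_iff {U : Set (Sym Γ.Point d)} : IsOpen U ↔ IsOpen (symOf ⁻¹' U) :=
  isOpen_coinduced

/-- Equal multiplicities give bijections fibre by fibre. -/
theorem exists_perm_of_map_eq {ι X : Type*} [Fintype ι] {p c : ι → X}
    (h : Multiset.map p Finset.univ.val = Multiset.map c Finset.univ.val) :
    ∃ σ : Equiv.Perm ι, ∀ i, c (σ i) = p i := by
  classical
  have h1 : ∀ y, Nonempty ({i // p i = y} ≃ {i // c i = y}) := fun y => by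
    rw [← Fintype.card_eq, Fintype.card_subtype, Fintype.card_subtype]
    have h2 := congrArg (Multiset.count y) h
    rw [Multiset.count_map, Multiset.count_map] at h2
    simp only [eq_comm (a := y)] at h2
    exact h2
  exact ⟨Equiv.ofFiberEquiv fun y => (h1 y).some, fun i => Equiv.ofFiberEquiv_map _ i⟩

open Classical in
/-- Effective divisors with enough mass near the points of `E` are close to `E`. -/
theorem exists_nhds_sym [T2Space Γ.Point] {U : Set (Sym Γ.Point d)} (hU : IsOpen U)
    {E : Sym Γ.Point d} (hE : E ∈ U) : ∃ W : Γ.Point → Set Γ.Point,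
      (∀ y ∈ E.1, IsOpen (W y) ∧ y ∈ W y) ∧
      ∀ m : Sym Γ.Point d, (∀ y ∈ E.1, E.1.count y ≤ m.1.countP (· ∈ W y)) → m ∈ U := by
  obtain ⟨p, rfl⟩ := exists_symOf E
  obtain ⟨u, hu, huU⟩ := isOpen_pi_iff'.1 (isOpen_sym_iff.1 hU) p hE
  obtain ⟨T, hT, hTd⟩ := (Set.finite_range p).t2_separation
  have hmem : ∀ y, y ∈ (symOf p).1 ↔ ∃ i, p i = y := fun y => by simp [symOf]
  -- `W y` is the separating neighbourhood of `y`, cut down to every factor of the box whose centre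
  -- is `y`.
  obtain ⟨W, hW⟩ : ∃ W : Γ.Point → Set Γ.Point, ∀ y, W y = T y ∩ ⋂ i, ⋂ _ : p i = y, u i :=
    ⟨_, fun _ => rfl⟩
  have hWT : ∀ y, W y ⊆ T y := fun y => by rw [hW]; exact inter_subset_left
  have hWu : ∀ i, W (p i) ⊆ u i := fun i x hx => by
    rw [hW] at hx
    have h2 := hx.2
    simp only [mem_iInter] at h2
    exact h2 i rfl
  have hpW : ∀ i, p i ∈ W (p i) := fun i => by
    rw [hW]
    refine ⟨(hT _).1, ?_⟩
    simp only [mem_iInter]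
    exact fun j hj => hj ▸ (hu j).2
  refine ⟨W, fun y hy => ⟨?_, ?_⟩, fun m hm => ?_⟩
  · rw [hW]
    exact (hT y).2.inter
      (isOpen_iInter_of_finite fun i => isOpen_iInter_of_finite fun _ => (hu i).1)
  · obtain ⟨i, rfl⟩ := (hmem y).1 hy
    exact hpW i
  obtain ⟨q, rfl⟩ := exists_symOf m
  have hdisj : ∀ i i' x, x ∈ W (p i) → x ∈ W (p i') → p i = p i' := fun i i' x h h' => by
    by_contra hne
    exact Set.disjoint_left.1 (hTd (mem_range_self i) (mem_range_self i') hne) (hWT _ h) (hWT _ h')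
  -- `c j` is the centre whose neighbourhood contains `q j`, unique by disjointness. If there is
  -- none, the default `q j` differs from every centre.
  let c : Fin d → Γ.Point := fun j => if h : ∃ i, q j ∈ W (p i) then p h.choose else q j
  have hA : ∀ i j, q j ∈ W (p i) → p i = c j := fun i j h => by
    have h' : ∃ i, q j ∈ W (p i) := ⟨i, h⟩
    simp only [c, dif_pos h']
    exact hdisj _ _ _ h h'.choose_spec
  have hB : ∀ i j, c j = p i → q j ∈ W (p i) := fun i j h => by
    by_cases h' : ∃ i, q j ∈ W (p i)
    · simp only [c, dif_pos h'] at h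
      exact h ▸ h'.choose_spec
    · simp only [c, dif_neg h'] at h
      exact absurd ⟨i, h ▸ hpW i⟩ h'
  -- By the mass hypothesis each centre occurs among the `c j` at least as often as among the `p i`.
  -- Both families have `d` members, so they agree up to a permutation, which moves `q` into the
  -- box.
  have hle : Multiset.map p Finset.univ.val ≤ Multiset.map c Finset.univ.val := by
    rw [Multiset.le_iff_count]
    intro y
    by_cases hy : y ∈ (symOf p).1
    · refine (hm y hy).trans ?_
      obtain ⟨i, rfl⟩ := (hmem y).1 hy
      change Multiset.countP _ (Multiset.map q Finset.univ.val) ≤ _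
      rw [Multiset.countP_map, Multiset.count_map]
      exact Multiset.card_le_card (Multiset.monotone_filter_right _ fun j hj => hA i j hj)
    · rw [show Multiset.count y (Multiset.map p Finset.univ.val) = 0 from
        Multiset.count_eq_zero.2 hy]
      exact Nat.zero_le _
  have heq := Multiset.eq_of_le_of_card_le hle (by simp)
  obtain ⟨σ, hσ⟩ := exists_perm_of_map_eq heq
  have h1 : symOf (q ∘ σ) = symOf q := Subtype.ext <| by
    change Multiset.map (q ∘ σ) Finset.univ.val = Multiset.map q Finset.univ.val
    rw [← Multiset.map_map, Multiset.map_univ_val_equiv]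
  rw [← h1]
  exact huU fun i _ => hWu i (hB i (σ i) (hσ i))

open Classical in
theorem sum_map_eq_finsum (m : Multiset Γ.Point) (φ : Γ.Point → ℝ) :
    (m.map φ).sum = ∑ᶠ x, φ x * (m.count x : ℤ) := by
  rw [Finset.sum_multiset_map_count, finsum_eq_sum_of_support_subset (s := m.toFinset)]
  · exact Finset.sum_congr rfl fun x _ => by rw [nsmul_eq_mul, mul_comm]; norm_cast
  · intro x hx
    by_contra h
    refine hx ?_
    have h1 : Multiset.count x m = 0 := Multiset.count_eq_zero.2 fun h2 => h (by simpa using h2)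
    simp [h1]

variable [Finite V] {D : Γ.Point →₀ ℤ}

/-- `D + div f` is effective, and of degree `d` because principal divisors have degree zero. -/
theorem exists_sym_eq (hd : D.degree = (d : ℤ)) {f : C(Γ.Point, ℝ)} (hf : f ∈ RatD D) :
    ∃ E : Sym Γ.Point d, ∀ x, symDivisor E x = D x + ord f x := by
  classical
  obtain ⟨Q₀, hQ₀⟩ := Rat.exists_isBreakSet hf.1
  have hQ := hQ₀.mono (Finset.subset_union_left (s₂ := D.support))
  set Q := Q₀ ∪ D.support
  have hDQ : D.support ⊆ Q := Finset.subset_union_right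
  let c : Γ.Point →₀ ℕ := Finsupp.onFinset Q (fun x => (D x + ord f x).toNat) fun x hx => by
    by_contra hxQ
    refine hx ?_
    rw [hQ.ord_eq_zero hxQ, Finsupp.notMem_support_iff.1 fun h => hxQ (hDQ h)]
    rfl
  have hc : ∀ x, (c x : ℤ) = D x + ord f x := fun x => Int.toNat_of_nonneg (hf.2 x)
  have hcard : Multiset.card (Finsupp.toMultiset c) = d := by
    rw [Finsupp.card_toMultiset, Finsupp.onFinset_sum _ (by simp)]
    have h1 : ∑ x ∈ Q, (D x : ℤ) = d := by
      rw [← hd, Finsupp.degree_apply]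
      exact (Finset.sum_subset hDQ fun x _ hx => Finsupp.notMem_support_iff.1 hx).symm
    have h2 : ∑ x ∈ Q, ord f x = 0 := by
      have h3 := finsum_ord hf.1
      have h4 := finsum_mul_ord_eq_sum (φ := fun _ => 1) hQ
      simp only [one_mul] at h4
      rw [h3] at h4
      exact_mod_cast h4.symm
    have h5 : ∑ x ∈ Q, (c x : ℤ) = d := by
      rw [Finset.sum_congr rfl fun x _ => hc x, Finset.sum_add_distrib, h1, h2, add_zero]
    exact_mod_cast h5
  refine ⟨⟨Finsupp.toMultiset c, hcard⟩, fun x => ?_⟩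
  rw [← hc]
  have h := Finsupp.count_toMultiset c x
  unfold symDivisor
  convert congrArg (Nat.cast (R := ℤ)) h
  rfl

/-- Green's identity moves the order from `f` to `φ`, so that only the values of `f` where `φ` bends
matter. -/
theorem sum_map_sym {f φ : C(Γ.Point, ℝ)} (hf : f ∈ Γ.Rat) (hφ : φ ∈ Γ.Rat) {E : Sym Γ.Point d}
    (hE : ∀ x, symDivisor E x = D x + ord f x) :
    (E.1.map φ).sum = ∑ᶠ x, φ x * D x + ∑ᶠ x, f x * ord φ x := by
  classical
  obtain ⟨Q, hQ⟩ := Rat.exists_isBreakSet hf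
  rw [sum_map_eq_finsum, ← finsum_mul_ord_comm hφ hf, ← finsum_add_distrib]
  · refine finsum_congr fun x => ?_
    rw [← mul_add]
    congr 1
    exact_mod_cast hE x
  · refine (D.support.finite_toSet).subset fun x hx => ?_
    by_contra h
    exact hx (by simp [Finsupp.notMem_support_iff.1 h])
  · refine Q.finite_toSet.subset fun x hx => ?_
    by_contra h
    exact hx (by simp [hQ.ord_eq_zero h])

theorem sum_map_le {X : Type*} (W : Set X) [DecidablePred (· ∈ W)] {φ : X → ℝ} {h : ℝ}
    (h1 : ∀ x, φ x ≤ h) (h0 : ∀ x ∉ W, φ x = 0) (m : Multiset X) :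
    (m.map φ).sum ≤ h * m.countP (· ∈ W) := by
  induction m using Multiset.induction_on with
  | empty => simp
  | cons a m ih =>
    rw [Multiset.map_cons, Multiset.sum_cons, Multiset.countP_cons]
    by_cases ha : a ∈ W
    · rw [if_pos ha]
      push_cast
      linarith [h1 a]
    · rw [if_neg ha, h0 a ha]
      simpa using ih

open Classical in
theorem count_mul_le_sum_map {X : Type*} {φ : X → ℝ} (h0 : ∀ x, 0 ≤ φ x) {m : Multiset X} {y : X}
    (hy : y ∈ m) : m.count y * φ y ≤ (m.map φ).sum := by
  rw [Finset.sum_multiset_map_count, ← nsmul_eq_mul]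
  exact Finset.single_le_sum (f := fun a => m.count a • φ a) (fun x _ => nsmul_nonneg (h0 x) _)
    (by simpa using hy)

/-- The divisor of a rational function depends continuously on the function. -/
theorem continuous_sym {Y : Type*} [TopologicalSpace Y] {f : Y → C(Γ.Point, ℝ)}
    (hf : ∀ w, f w ∈ Γ.Rat) (hc : ∀ x, Continuous fun w => f w x) {F : Y → Sym Γ.Point d}
    (hF : ∀ w x, symDivisor (F w) x = D x + ord (f w) x) : Continuous F := by
  classical
  refine continuous_iff_continuousAt.2 fun v => ?_
  rw [ContinuousAt, tendsto_nhds]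
  intro U hU hv
  obtain ⟨W, hW, hWU⟩ := exists_nhds_sym hU hv
  suffices H : ∀ᶠ w in 𝓝 v, ∀ y ∈ (F v).1.toFinset,
      (F v).1.count y ≤ (F w).1.countP (· ∈ W y) by
    filter_upwards [H] with w hw
    exact hWU _ fun y hy => hw y (by simpa using hy)
  rw [eventually_all_finset]
  intro y hy
  have hy : y ∈ (F v).1 := by simpa using hy
  obtain ⟨φ, hφ, hφ1, hφ0, hφW⟩ := exists_tent (hW y hy).1 (hW y hy).2
  obtain ⟨Q, hQ⟩ := Rat.exists_isBreakSet hφ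
  -- The sum involves `f w` at finitely many fixed points, so pointwise continuity in `w` suffices.
  have hT : Continuous fun w => ((F w).1.map φ).sum := by
    simp only [fun w => sum_map_sym (hf w) hφ (hF w), finsum_mul_ord_eq_sum hQ]
    exact continuous_const.add (continuous_finsetSum _ fun x _ => (hc x).mul continuous_const)
  have h1 := count_mul_le_sum_map (fun x => (hφ1 x).1) hy
  -- The slack of one unit turns an open condition on `w` into the bound on multiplicities, which
  -- are integers.
  have h2 : φ y * ((F v).1.count y - 1) < ((F v).1.map φ).sum := by linarith
  filter_upwards [hT.continuousAt.eventually (lt_mem_nhds h2)] with w hw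
  have h3 := hw.trans_le (sum_map_le (W y) (fun x => (hφ1 x).2) hφW (F w).1)
  have h4 := lt_of_mul_lt_mul_left h3 hφ0.le
  have h5 : ((F v).1.count y : ℝ) < (F w).1.countP (· ∈ W y) + 1 := by linarith
  exact Nat.lt_add_one_iff.1 (by exact_mod_cast h5)

end MetricGraph

namespace MetricGraph

variable {V : Type*} {Γ : MetricGraph V} [Finite V]

/-! ### Uniqueness and kinks -/

/-- A rational function is determined by its divisor up to a constant. -/
theorem exists_eq_add_const {f g : C(Γ.Point, ℝ)} (hf : f ∈ Γ.Rat) (hg : g ∈ Γ.Rat)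
    (h : ∀ x, ord f x = ord g x) (x₀ : Γ.Point) : ∃ c, ∀ x, f x = g x + c := by
  obtain ⟨y, -, hy⟩ := isCompact_univ.exists_isMaxOn ⟨x₀, trivial⟩ (f := fun x => f x - g x)
    (f.continuous.sub g.continuous).continuousOn
  have hy : ∀ x, f x - g x ≤ f y - g y := fun x => hy (mem_univ x)
  -- At a maximum of `f - g` all outgoing slopes are at most `0`; equal orders make their sum zero,
  -- so they all vanish. Hence the maximum locus is open as well as closed.
  let Z : Set Γ.Point := {x | f x - g x = f y - g y}
  have hslope : ∀ x ∈ Z, ∀ ν : Γ.Tangent x,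
      edgeSlope f ν.dart ν.pos = edgeSlope g ν.dart ν.pos := by
    intro x hx ν
    have hle : ∀ ν ∈ (Finset.univ : Finset (Γ.Tangent x)),
        edgeSlope f ν.dart ν.pos - edgeSlope g ν.dart ν.pos ≤ 0 := by
      intro ν _
      obtain ⟨s, ⟨h1, h2⟩, hs⟩ := (((Rat.hasEdgeSlope hf ν.pos_nonneg ν.pos_lt).and
        (Rat.hasEdgeSlope hg ν.pos_nonneg ν.pos_lt)).and self_mem_nhdsWithin).exists
      have hs : 0 < s := hs
      rw [ν.base] at h1 h2
      have hx : f x - g x = f y - g y := hx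
      have h3 := hy (Γ.pt ν.dart (ν.pos + s))
      have h4 : ((edgeSlope f ν.dart ν.pos : ℝ) - edgeSlope g ν.dart ν.pos) * s ≤ 0 * s := by
        linarith
      have h5 := le_of_mul_le_mul_right h4 hs
      exact_mod_cast h5
    have hsum : ∑ ν : Γ.Tangent x,
        (edgeSlope f ν.dart ν.pos - edgeSlope g ν.dart ν.pos) = 0 := by
      have := h x
      rw [ord_eq, ord_eq] at this
      rw [Finset.sum_sub_distrib]
      linarith
    exact sub_eq_zero.1 ((Finset.sum_eq_zero_iff_of_nonpos hle).1 hsum ν (Finset.mem_univ _))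
  have hZc : IsClosed Z := isClosed_eq (f.continuous.sub g.continuous) continuous_const
  have hZo : IsOpen Z := by
    refine isOpen_point_iff.2 fun e t ht htZ => ?_
    have htZ' : f (Γ.pt e t) - g (Γ.pt e t) = f y - g y := htZ
    have hr : ∃ b, t < b ∧ ∀ s, t ≤ s → s < b → s ≤ Γ.len e → Γ.pt e s ∈ Z := by
      rcases ht.2.eq_or_lt with h1 | h1
      · refine ⟨t + 1, by linarith, fun s hs _ hl => ?_⟩
        obtain rfl : s = t := by linarith
        exact htZ
      · obtain ⟨b₁, hb₁, -, h₁⟩ := Rat.exists_affine hf e ht.1 h1 le_rfl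
        obtain ⟨b₂, hb₂, -, h₂⟩ := Rat.exists_affine hg e ht.1 h1 le_rfl
        refine ⟨min b₁ b₂, lt_min hb₁ hb₂, fun s hs hsb _ => ?_⟩
        have h3 := h₁ s ⟨hs, (hsb.trans_le (min_le_left _ _)).le⟩
        have h4 := h₂ s ⟨hs, (hsb.trans_le (min_le_right _ _)).le⟩
        have h5 := hslope _ htZ ⟨e, t, ht.1, h1, rfl⟩
        change f (Γ.pt e s) - g (Γ.pt e s) = f y - g y
        dsimp only at h5
        rw [h3, h4, h5]
        linarith
    have hl : ∃ a, a < t ∧ ∀ s, a < s → s ≤ t → 0 ≤ s → Γ.pt e s ∈ Z := by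
      rcases ht.1.eq_or_lt with h1 | h1
      · refine ⟨t - 1, by linarith, fun s _ hs hl => ?_⟩
        obtain rfl : s = t := by linarith
        exact htZ
      · obtain ⟨a₁, -, ha₁, h₁⟩ := Rat.exists_affine_left hf e le_rfl h1 ht.2
        obtain ⟨a₂, -, ha₂, h₂⟩ := Rat.exists_affine_left hg e le_rfl h1 ht.2
        refine ⟨max a₁ a₂, max_lt ha₁ ha₂, fun s hsa hs _ => ?_⟩
        have h3 := h₁ s ⟨((le_max_left _ _).trans_lt hsa).le, hs⟩
        have h4 := h₂ s ⟨((le_max_right _ _).trans_lt hsa).le, hs⟩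
        have h5 := hslope _ htZ ⟨e.symm, Γ.len e - t, by linarith [ht.2],
          by rw [Γ.len_symm]; linarith, pt_symm e ht⟩
        change f (Γ.pt e s) - g (Γ.pt e s) = f y - g y
        dsimp only at h5
        rw [h3, h4, h5]
        linarith
    obtain ⟨b, hb, hb'⟩ := hr
    obtain ⟨a, ha, ha'⟩ := hl
    filter_upwards [nhdsWithin_le_nhds (Ioo_mem_nhds ha hb), self_mem_nhdsWithin] with s hs hsI
    rcases le_total t s with h1 | h1
    · exact hb' s h1 hs.2 hsI.2
    · exact ha' s hs.1 h1 hsI.1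
  refine ⟨f y - g y, fun x => ?_⟩
  have hx : f x - g x = f y - g y := eq_univ_of_isClopen ⟨hZc, hZo⟩ (show y ∈ Z from rfl) x
  linarith

variable {r : ℕ} {D : Γ.Point →₀ ℤ} {S : Γ.SlopeStructure r} {M : Set C(Γ.Point, ℝ)}

/-- A linear series contains functions with a maximal change of slope at a given interior point. -/
theorem IsLinearSeries.exists_kink (hM : IsLinearSeries D S M) {e : Γ.graph.Dart} {t : ℝ}
    (h0 : 0 < t) (h1 : t < Γ.len e) : ∃ g ∈ M, edgeSlope g e t = S.slopes e 0 ∧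
      edgeSlope g e.symm (Γ.len e - t) = -S.slopes e (Fin.last r) := by
  -- For the divisor `r · x` at an interior point, standard rank at least `r` forces `a = 0`: both
  -- outgoing slopes are the smallest allowed. On the reversed edge the smallest slope is `-s_r`.
  obtain ⟨g, hg, hr, -⟩ := hM.rank (Finsupp.single (Γ.pt e t) (r : ℤ)) (by simp) (by simp)
  obtain ⟨a, ha, hra⟩ := hr (Γ.pt e t)
  rw [S.rank_interior e t h0 h1, Finsupp.single_eq_same, standardRank] at hra
  have hz : ∀ ν, a ν = 0 := by
    split_ifs at hra with hs
    · have h2 : ∑ ν, (a ν : ℕ) = 0 := by omega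
      intro ν
      exact Fin.ext (Finset.sum_eq_zero_iff.1 h2 ν (Finset.mem_univ _))
    · omega
  have key : ∀ ν : Γ.Tangent (Γ.pt e t), edgeSlope g ν.dart ν.pos = S.slopes ν.dart 0 := fun ν => by
    rw [← slope_eq_edgeSlope, ← hz ν]
    exact congrFun ha ν
  have h2 := S.slopes_symm e (Fin.last r)
  rw [Fin.rev_last] at h2
  refine ⟨g, hg, key ⟨e, t, h0.le, h1, rfl⟩, ?_⟩
  have h3 := key ⟨e.symm, Γ.len e - t, by linarith, by rw [Γ.len_symm]; linarith,
    pt_symm e ⟨h0.le, h1.le⟩⟩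
  dsimp only at h3
  rw [h3]
  linarith

/-- The elements of a linear series of positive rank do not all agree up to constants on a
segment. -/
theorem IsLinearSeries.not_rigid (hM : IsLinearSeries D S M) (hr : 1 ≤ r) {e : Γ.graph.Dart}
    {a b : ℝ} (h0 : 0 ≤ a) (hab : a < b) (h1 : b ≤ Γ.len e) :
    ¬ ∀ g ∈ M, ∀ g' ∈ M, ∀ s ∈ Icc a b, ∀ t ∈ Icc a b,
      g (Γ.pt e s) - g (Γ.pt e t) = g' (Γ.pt e s) - g' (Γ.pt e t) := by
  intro H
  -- `g` leaves `y` with slope `s_0` up to `c`, and `g'` arrives at `c` with slope `s_r` from some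
  -- `z > y`. Agreement up to a constant on `[z, c]` would give `s_0 = s_r`.
  obtain ⟨y, hay, hyb⟩ := exists_between hab
  obtain ⟨g, hg, hgr, -⟩ := hM.exists_kink (e := e) (t := y) (by linarith) (by linarith)
  obtain ⟨c, hyc, hcb, hc⟩ := Rat.exists_affine (hM.subset hg).1.1 e (a := y) (by linarith) hyb h1
  obtain ⟨g', hg', -, hgl⟩ := hM.exists_kink (e := e) (t := c) (by linarith) (by linarith)
  obtain ⟨z, hyz, hzc, hz⟩ := Rat.exists_affine_left (hM.subset hg').1.1 e (c := y) (b := c)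
    (by linarith) hyc (by linarith)
  have h2 := H g hg g' hg' z ⟨by linarith, by linarith⟩ c ⟨by linarith, by linarith⟩
  rw [hz z ⟨le_rfl, hzc.le⟩, hc z ⟨hyz.le, hzc.le⟩, hc c ⟨hyc.le, le_rfl⟩, hgr, hgl] at h2
  push_cast at h2
  have h3 : (S.slopes e 0 : ℝ) * (z - c) = S.slopes e (Fin.last r) * (z - c) := by linarith
  have h4 := mul_right_cancel₀ (by linarith : z - c ≠ 0) h3
  have h5 : (0 : Fin (r + 1)) < Fin.last r := by
    rw [Fin.lt_def]
    exact hr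
  have h6 := S.strictMono e h5
  have h7 : S.slopes e 0 = S.slopes e (Fin.last r) := by exact_mod_cast h4
  linarith

end MetricGraph

/-! ### The map to reduced divisors. -/

theorem mainTheorem11 {V : Type*} [Finite V] (Γ : MetricGraph V) (r d : ℕ)
    (D : Γ.Point →₀ ℤ) (hd : D.degree = (d : ℤ)) (S : Γ.SlopeStructure r)
    (hDS : MetricGraph.IsCrudeLinearSeries D S)
    (M : Set C(Γ.Point, ℝ)) (hM : MetricGraph.IsLinearSeries D S M) :
    (∀ v : Γ.Point, (∀ x, BddBelow (Set.range fun g : M =>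
        (g : C(Γ.Point, ℝ)) x - (g : C(Γ.Point, ℝ)) v)) ∧
      ∃ f ∈ M, ⇑f = MetricGraph.reducedFun M v) ∧
    ∃ Red : Γ.Point → MetricGraph.linearSystem d D M,
      (∀ v x, MetricGraph.symDivisor (Red v).1 x = MetricGraph.reducedDivisor D M v x) ∧
      Continuous Red ∧ (1 ≤ r → MetricGraph.IsNonContracting Red) := by
  have hmem := fun v => hM.reducedMap_mem v
  choose R hR using fun v => MetricGraph.exists_sym_eq hd (hM.subset (hmem v)).1
  refine ⟨fun v => ⟨hM.bddBelow v, _, hmem v, rfl⟩, fun v => ⟨R v, _, hmem v, hR v⟩, hR, ?_, ?_⟩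
  · exact (MetricGraph.continuous_sym (fun v => (hM.subset (hmem v)).1.1)
      hM.continuous_reducedFun_left hR).subtype_mk _
  · rintro hr e a b h0 hab h1 ⟨c, hc⟩
    -- With a constant divisor, each `f_t` for `t` in the segment is `f_a` plus a constant. So
    -- `f_a(s) - f_a(t) = f_t(s) ≤ g(s) - g(t)`, and exchanging `s` and `t` gives equality for every
    -- `g ∈ M`.
    have hle : ∀ g ∈ M, ∀ s ∈ Icc a b, ∀ t ∈ Icc a b,
        MetricGraph.reducedFun M (Γ.pt e a) (Γ.pt e s) -
          MetricGraph.reducedFun M (Γ.pt e a) (Γ.pt e t) ≤ g (Γ.pt e s) - g (Γ.pt e t) := by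
      intro g hg s hs t ht
      have h2 : R (Γ.pt e t) = R (Γ.pt e a) :=
        congrArg Subtype.val ((hc t ht).trans (hc a ⟨le_rfl, hab.le⟩).symm)
      obtain ⟨k, hk⟩ := MetricGraph.exists_eq_add_const (hM.reducedMap_mem_rat (Γ.pt e t))
        (hM.reducedMap_mem_rat (Γ.pt e a)) (fun x => by
          have h3 := hR (Γ.pt e t) x
          rw [h2, hR] at h3
          linarith) (Γ.pt e t)
      have h4 : MetricGraph.reducedFun M (Γ.pt e t) (Γ.pt e s) = _ := hk (Γ.pt e s)
      have h5 : MetricGraph.reducedFun M (Γ.pt e t) (Γ.pt e t) = _ := hk (Γ.pt e t)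
      rw [hM.reducedFun_self] at h5
      have h6 := hM.reducedFun_le hg (Γ.pt e t) (Γ.pt e s)
      change _ = MetricGraph.reducedFun M (Γ.pt e a) _ + k at h4
      change _ = MetricGraph.reducedFun M (Γ.pt e a) _ + k at h5
      linarith
    refine hM.not_rigid hr h0 hab h1 fun g hg g' hg' s hs t ht => ?_
    have := hle g hg s hs t ht
    have := hle g hg t ht s hs
    have := hle g' hg' s hs t ht
    have := hle g' hg' t ht s hs
    linarith
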